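/- Let $n\in\mathbb N$, $0\le\alpha<n$, $1<s<p$ with $\alpha p<n$ (that is, $p<n/\alpha$, with $n/\alpha=\infty$ if $\alpha=0$), and $\frac1q=\frac1p-\frac{\alpha}{n}$. All functions are complex-valued, measurable on $\mathbb R^n$, and identified when equal a.e. A weight is a measurable $\omega:\mathbb R^n\to[0,\infty)$ that is positive a.e.; $L^r_v$ is the space of $f$ with $\|f\|_{L^r_v}=\big(\int|f|^r v\,dx\big)^{1/r}<\infty$; $L^\infty_c$ is the space of essentially bounded functions with compact support. For $1<P<\infty$, $0<Q<\infty$ and $P'=P/(P-1)$, a weight $u$ belongs to $\mathcal A(P,Q)$ if $$\sup_B\Big(\frac1{|B|}\int_B u^{Q}\,dx\Big)^{1/Q}\Big(\frac1{|B|}\int_B u^{-P'}\,dx\Big)^{1/P'}<\infty ,$$ the supremum being over all balls. A locally integrable $b$ belongs to $BMO(\mathbb R^n)$ if $\sup_B\frac1{|B|}\int_B|b-b_B|\,dx<\infty$, where $b_B=\frac1{|B|}\int_B b\,dx$. Let $T$ be a linear operator, with values in measurable functions, defined on a vector space $D\supseteq L^\infty_c$ of measurable functions (for instance $D=L^\infty_c$).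 Suppose that for every $\omega$ with $\omega^s\in\mathcal A(\frac ps,\frac qs)$ there is a constant $C_\omega$ such that $$\|Tf\|_{L^q_{\omega^q}}\le C_\omega\|f\|_{L^p_{\omega^p}}\qquad\text{for all } f\in D\cap L^p_{\omega^p}.$$ Then for every $\omega$ with $\omega^s\in\mathcal A(\frac ps,\frac qs)$: (i) there is a unique bounded linear operator $T_\omega:L^p_{\omega^p}\to L^q_{\omega^q}$ that agrees with $T$ on $D\cap L^p_{\omega^p}$; (ii) for every $b\in BMO(\mathbb R^n)$, the functions $f$ and $bf$ belong to $L^p_{\omega^p}$ whenever $f\in L^\infty_c$, and the commutator $[b,T]$ extends to a bounded linear operator from $L^p_{\omega^p}$ to $L^q_{\omega^q}$: there is a bounded linear $S:L^p_{\omega^p}\to L^q_{\omega^q}$ such that $Sf=b\,T_\omega f-T_\omega(bf)$ for all $f\in L^p_{\omega^p}$ with $bf\in L^p_{\omega^p}$, in particular for all $f\in L^\infty_c$. Here $T_\omega f=Tf$ and $T_\omega(bf)=T(bf)$ whenever these functions lie in $D$. -/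

import Mathlib

open MeasureTheory
open scoped NNReal ENNReal

/-- `ℝⁿ` with its Euclidean norm and Lebesgue measure. -/
abbrev Rn (n : ℕ) : Type := EuclideanSpace ℝ (Fin n)

/-- Complex-valued measurable functions on `ℝⁿ` modulo equality almost everywhere. -/
abbrev L0 (n : ℕ) : Type := Rn n →ₘ[(volume : Measure (Rn n))] ℂ

/-- A weight: a measurable function with values in `[0, ∞)`, positive almost everywhere. -/
def IsWeight {n : ℕ} (w : Rn n → ℝ≥0) : Prop :=
  Measurable w ∧ ∀ᵐ x ∂(volume : Measure (Rn n)), 0 < w x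

/-- The measure `v(x) dx`. -/
noncomputable def weightMeasure {n : ℕ} (v : Rn n → ℝ≥0) : Measure (Rn n) :=
  (volume : Measure (Rn n)).withDensity (fun x => (v x : ℝ≥0∞))

theorem weightMeasure_absolutelyContinuous {n : ℕ} (v : Rn n → ℝ≥0) :
    weightMeasure v ≪ (volume : Measure (Rn n)) :=
  withDensity_absolutelyContinuous _ _

/-- The norm `‖f‖_{L^p_v} = (∫ |f(x)|^p v(x) dx)^{1/p}`, with values in `[0, ∞]`. -/
noncomputable def weightedNorm {n : ℕ} (p : ℝ) (v : Rn n → ℝ≥0) (f : L0 n) : ℝ≥0∞ :=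
  eLpNorm f (ENNReal.ofReal p) (weightMeasure v)

/-- The weighted Lebesgue space `L^p_v(ℝⁿ)`. -/
noncomputable def WeightedLp {n : ℕ} (p : ℝ) (v : Rn n → ℝ≥0) : Submodule ℂ (L0 n) where
  carrier := {f | MemLp f (ENNReal.ofReal p) (weightMeasure v)}
  zero_mem' :=
    (MemLp.zero' (p := ENNReal.ofReal p) (μ := weightMeasure v)).ae_eq
      ((weightMeasure_absolutelyContinuous v).ae_eq AEEqFun.coeFn_zero).symm
  add_mem' := fun {f g} hf hg =>
    (MemLp.add hf hg).ae_eq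
      ((weightMeasure_absolutelyContinuous v).ae_eq (AEEqFun.coeFn_add f g)).symm
  smul_mem' := fun c f hf =>
    (MemLp.const_smul hf c).ae_eq
      ((weightMeasure_absolutelyContinuous v).ae_eq (AEEqFun.coeFn_smul c f)).symm

/-- `L^∞_c(ℝⁿ)`: essentially bounded functions vanishing almost everywhere off a compact set. -/
def MemLinftyC {n : ℕ} (f : L0 n) : Prop :=
  MemLp f ⊤ (volume : Measure (Rn n)) ∧
    ∃ K : Set (Rn n), IsCompact K ∧ ∀ᵐ x ∂(volume : Measure (Rn n)), x ∉ K → f x = 0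

/-- The Muckenhoupt-Wheeden class `A(p, q)` for `1 < p < ∞`, `0 < q < ∞`: weights `w` with
`sup_B (⨍_B w^q)^{1/q} (⨍_B w^{-p'})^{1/p'} < ∞`, where `p' = p / (p - 1)`. Powers and averages are
taken in `[0, ∞]`, so that the bound includes finiteness of both averages. -/
def MemApq {n : ℕ} (p q : ℝ) (w : Rn n → ℝ≥0) : Prop :=
  IsWeight w ∧ ∃ C : ℝ≥0, ∀ (x : Rn n) (r : ℝ), 0 < r →
    (⨍⁻ y in Metric.ball x r, (w y : ℝ≥0∞) ^ q ∂volume) ^ (1 / q) *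
      (⨍⁻ y in Metric.ball x r, (w y : ℝ≥0∞) ^ (-(p / (p - 1))) ∂volume) ^ (1 / (p / (p - 1)))
      ≤ (C : ℝ≥0∞)

/-- `BMO(ℝⁿ)`: locally integrable functions of bounded mean oscillation over balls. -/
def MemBMO {n : ℕ} (b : L0 n) : Prop :=
  LocallyIntegrable b (volume : Measure (Rn n)) ∧
    ∃ C : ℝ, ∀ (x : Rn n) (r : ℝ), 0 < r →
      ⨍ y in Metric.ball x r, ‖b y - ⨍ z in Metric.ball x r, b z ∂volume‖ ∂volume ≤ C

/-- Boundedness of a linear operator from `L^p_{w^p}` to `L^q_{w^q}`. -/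
def IsBoundedOp {n : ℕ} {p q : ℝ} {w : Rn n → ℝ≥0}
    (S : WeightedLp p (fun x => w x ^ p) →ₗ[ℂ] WeightedLp q (fun x => w x ^ q)) : Prop :=
  ∃ C : ℝ≥0, ∀ f, weightedNorm q (fun x => w x ^ q) (S f : L0 n) ≤
    C * weightedNorm p (fun x => w x ^ p) (f : L0 n)

/-- `S` is a bounded operator from `L^p_{w^p}` to `L^q_{w^q}` that agrees with the (partially
defined) operator `T` on all functions of `L^p_{w^p}` in the domain of `T`. -/
def IsBoundedExtension {n : ℕ} {p q : ℝ} {w : Rn n → ℝ≥0} (T : L0 n →ₗ.[ℂ] L0 n)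
    (S : WeightedLp p (fun x => w x ^ p) →ₗ[ℂ] WeightedLp q (fun x => w x ^ q)) : Prop :=
  IsBoundedOp S ∧ ∀ (f : T.domain) (hf : (f : L0 n) ∈ WeightedLp p (fun x => w x ^ p)),
    (S ⟨f, hf⟩ : L0 n) = T f

/-! The proof is the conjugation method. For real `r`, the commutator `[r, T]` is the derivative at
`z = 0` of `exp (z r) T exp (-z r)`, and boundedness of this conjugate between the spaces weighted
by `w` is boundedness of `T` for the weight `w * exp (Re z * r)`. Two facts are needed: for small
`ε` both weights `w * exp (± ε r)` remain in the class, and the two resulting bounds control the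
derivative.

Stability of the class (`MemApq.exists_mul_exp`): the Muckenhoupt–Wheeden condition couples the
densities `V = u ^ Q` and `S = u ^ (-P')`, and Hölder's inequality turns it into an `A_∞` property
of each: a set filling at most a quarter of a cube carries at most a fraction `ρ < 1` of its mass. A
Calderón–Zygmund stopping argument iterated with this property gives John–Nirenberg directly with
respect to `V` and `S` (`exists_exp_oscillation_le`), so reverse Hölder inequalities are not used.
The exponentials of the local constants cancel in the Muckenhoupt product.

The derivative (`norm_deriv_zero_le_of_strip`): the constant `C_ω` depends on the weight in an
unknown way, so no uniform bound over a circle around `0` is given. Instead `r` is truncated, which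
makes the conjugated family bounded and holomorphic on a strip. Phragmén–Lindelöf carries the bounds
from the lines `Re z = ± ε`, where only two weights occur, to the whole strip, and Cauchy's estimate
on `|z| = ε` bounds the commutator by `C / ε` independently of the truncation. Limits and Fatou's
lemma remove the truncation (`eLpNorm_commutator_le`).

A complex `b` is split into real and imaginary parts. The commutator on all `f` with `f` and `b f`
in the weighted space is then a densely defined bounded operator, and extends by continuity. -/

/-! ### Half-open cubes and their comparison with balls. -/

section Cubes

variable {n : ℕ}

/-- The half-open cube with lower corner `a` and side length `l`. -/
def cube (a : Rn n) (l : ℝ) : Set (Rn n) := {x | ∀ i, x i ∈ Set.Ico (a i) (a i + l)}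

theorem cube_eq_preimage (a : Rn n) (l : ℝ) :
    cube a l = (WithLp.ofLp : Rn n → Fin n → ℝ) ⁻¹'
      (Set.univ.pi fun i => Set.Ico (a i) (a i + l)) := by
  ext x; simp [cube, Set.mem_pi]

theorem measurableSet_cube (a : Rn n) (l : ℝ) : MeasurableSet (cube a l) := by
  rw [cube_eq_preimage]
  exact (PiLp.volume_preserving_ofLp (Fin n)).measurable
    (MeasurableSet.univ_pi fun i => measurableSet_Ico)

theorem volume_cube (a : Rn n) (l : ℝ) : volume (cube a l) = ENNReal.ofReal l ^ n := by
  rw [cube_eq_preimage, (PiLp.volume_preserving_ofLp (Fin n)).measure_preimage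
    (MeasurableSet.univ_pi fun i => measurableSet_Ico).nullMeasurableSet, Real.volume_pi_Ico]
  simp

theorem volume_cube_ne_top (a : Rn n) (l : ℝ) : volume (cube a l) ≠ ∞ := by
  rw [volume_cube]; finiteness

theorem volume_cube_ne_zero (a : Rn n) {l : ℝ} (hl : 0 < l) : volume (cube a l) ≠ 0 := by
  rw [volume_cube]; positivity

theorem cube_subset_closedBall (a : Rn n) {l : ℝ} (hl : 0 < l) {x : Rn n} (hx : x ∈ cube a l) :
    cube a l ⊆ Metric.closedBall x ((√n + 1) * l) := by
  intro y hy
  rw [Metric.mem_closedBall, EuclideanSpace.dist_eq]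
  calc √(∑ i, dist (y i) (x i) ^ 2) ≤ √(∑ _i : Fin n, l ^ 2) := by
        gcongr with i
        have h1 := hx i
        have h2 := hy i
        simp only [Set.mem_Ico] at h1 h2
        rw [Real.dist_eq, abs_le]
        constructor <;> linarith
    _ = √n * l := by
        simp [Real.sqrt_sq hl.le]
    _ ≤ (√n + 1) * l := by nlinarith

theorem ball_subset_cube (x : Rn n) (r : ℝ) :
    Metric.ball x r ⊆ cube (x - WithLp.toLp 2 fun _ => r) (2 * r) := by
  intro y hy i
  have h1 := PiLp.norm_apply_le (y - x) i
  rw [Metric.mem_ball, dist_eq_norm] at hy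
  have h2 := h1.trans_lt hy
  simp only [PiLp.sub_apply, Real.norm_eq_abs, abs_lt] at h2
  simp only [PiLp.sub_apply, Set.mem_Ico]
  constructor <;> linarith

/-- A bound for the volume ratio of comparable balls and cubes. -/
theorem exists_volume_closedBall_le (n : ℕ) (t : ℝ) (ht : 0 ≤ t) : ∃ κ : ℝ≥0,
    ∀ (x a : Rn n) (l : ℝ), 0 < l →
      volume (Metric.closedBall x (t * l)) ≤ κ * volume (cube a l) := by
  refine ⟨(ENNReal.ofReal (t ^ n) * volume (Metric.closedBall (0 : Rn n) 1)).toNNReal, ?_⟩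
  intro x a l hl
  have h : volume (Metric.closedBall (0 : Rn n) 1) ≠ ∞ := measure_closedBall_lt_top.ne
  rw [ENNReal.coe_toNNReal (by finiteness), Measure.addHaar_closedBall' _ _ (by positivity),
    volume_cube, finrank_euclideanSpace_fin, mul_pow, ENNReal.ofReal_mul (by positivity),
    ENNReal.ofReal_pow hl.le]
  apply le_of_eq; ring

theorem exists_ball_supset_cube (n : ℕ) : ∃ κ : ℝ≥0, ∀ (a : Rn n) (l : ℝ), 0 < l →
    ∃ (x : Rn n) (r : ℝ), 0 < r ∧ cube a l ⊆ Metric.ball x r ∧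
      volume (Metric.ball x r) ≤ κ * volume (cube a l) := by
  obtain ⟨κ, hκ⟩ := exists_volume_closedBall_le n (√n + 2) (by positivity)
  refine ⟨κ, fun a l hl => ⟨a, (√n + 2) * l, by positivity, ?_, ?_⟩⟩
  · refine (cube_subset_closedBall a hl (x := a) fun i => by simp [hl]).trans ?_
    exact Metric.closedBall_subset_ball (by nlinarith)
  · exact (measure_mono Metric.ball_subset_closedBall).trans (hκ a a l hl)

theorem exists_cube_supset_ball (n : ℕ) : ∃ κ : ℝ≥0, ∀ (x : Rn n) (r : ℝ), 0 < r →
    ∃ (a : Rn n) (l : ℝ), 0 < l ∧ Metric.ball x r ⊆ cube a l ∧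
      volume (cube a l) ≤ κ * volume (Metric.ball x r) := by
  have h0 : volume (Metric.ball (0 : Rn n) 1) ≠ 0 := (Metric.measure_ball_pos _ _ one_pos).ne'
  have h1 : volume (Metric.ball (0 : Rn n) 1) ≠ ∞ := measure_ball_lt_top.ne
  refine ⟨(2 ^ n * (volume (Metric.ball (0 : Rn n) 1))⁻¹).toNNReal, fun x r hr =>
    ⟨_, 2 * r, by positivity, ball_subset_cube x r, ?_⟩⟩
  rw [ENNReal.coe_toNNReal (by finiteness), volume_cube, Measure.addHaar_ball_of_pos _ _ hr,
    finrank_euclideanSpace_fin, ENNReal.ofReal_mul two_pos.le, mul_pow]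
  rw [mul_comm (ENNReal.ofReal _) (volume _), mul_assoc, ← mul_assoc _ (volume _),
    ENNReal.inv_mul_cancel h0 h1, one_mul, ENNReal.ofReal_pow hr.le]
  simp

/-! ### Dyadic cells, the Calderón–Zygmund decomposition and differentiation along cubes. -/

/-- The dyadic cell of generation `k` and index `m` attached to `cube a l`. -/
def cell (a : Rn n) (l : ℝ) (k : ℕ) (m : Fin n → ℤ) : Set (Rn n) :=
  cube (a + WithLp.toLp 2 fun i => m i * (l / 2 ^ k)) (l / 2 ^ k)

/-- Coding cells by integer floors reduces disjointness and nesting to arithmetic of floors. -/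
theorem mem_cell_iff {a : Rn n} {l : ℝ} (hl : 0 < l) {k : ℕ} {m : Fin n → ℤ} {x : Rn n} :
    x ∈ cell a l k m ↔ ∀ i, ⌊(x i - a i) / l * 2 ^ k⌋ = m i := by
  have h2 : (0 : ℝ) < 2 ^ k := by positivity
  refine forall_congr' fun i => ?_
  rw [Int.floor_eq_iff, Set.mem_Ico]
  simp only [PiLp.add_apply]
  have e : (x i - a i) / l * 2 ^ k = (x i - a i) / (l / 2 ^ k) := by field_simp
  have hd : 0 < l / 2 ^ k := by positivity
  rw [e, le_div_iff₀ hd, div_lt_iff₀ hd]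
  constructor <;> rintro ⟨h, h'⟩ <;> constructor <;> linarith

theorem cell_zero (a : Rn n) (l : ℝ) : cell a l 0 0 = cube a l := by
  simp [cell, cube]

theorem exists_mem_cell (a : Rn n) {l : ℝ} (hl : 0 < l) (k : ℕ) (x : Rn n) :
    ∃ m, x ∈ cell a l k m := ⟨_, (mem_cell_iff hl).2 fun _ => rfl⟩

theorem cell_index_unique {a : Rn n} {l : ℝ} (hl : 0 < l) {k : ℕ} {m m' : Fin n → ℤ} {x : Rn n}
    (h : x ∈ cell a l k m) (h' : x ∈ cell a l k m') : m = m' :=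
  funext fun i => ((mem_cell_iff hl).1 h i).symm.trans ((mem_cell_iff hl).1 h' i)

/-- The index of a point in a fine generation determines its index in a coarser one, through integer
division by a power of two. -/
theorem cell_subset_cell {a : Rn n} {l : ℝ} (hl : 0 < l) {k k' : ℕ} (hk : k ≤ k')
    {m m' : Fin n → ℤ} {x : Rn n} (h : x ∈ cell a l k m) (h' : x ∈ cell a l k' m') :
    cell a l k' m' ⊆ cell a l k m := by
  intro y hy
  rw [mem_cell_iff hl] at *
  intro i
  obtain ⟨d, rfl⟩ := Nat.exists_eq_add_of_le hk
  have key : ∀ t : ℝ, ⌊t * 2 ^ k⌋ = ⌊t * 2 ^ (k + d)⌋ / ((2 ^ d : ℕ) : ℤ) := by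
    intro t
    rw [← Int.floor_div_natCast]
    congr 1
    push_cast
    rw [pow_add]; field_simp
  rw [← h i, key, key, h' i, hy i]

theorem volume_cell_succ (a : Rn n) (l : ℝ) (k : ℕ) (m m' : Fin n → ℤ) :
    volume (cell a l k m) = 2 ^ n * volume (cell a l (k + 1) m') := by
  rw [cell, cell, volume_cube, volume_cube, ← mul_pow]
  congr 1
  rw [show l / 2 ^ k = 2 * (l / 2 ^ (k + 1)) by rw [pow_succ]; field_simp,
    ENNReal.ofReal_mul two_pos.le]
  simp

/-- The Calderón–Zygmund stopping cells of `cube a l` for `g` at height `t`. -/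
def stoppingCells (a : Rn n) (l : ℝ) (g : Rn n → ℝ≥0∞) (t : ℝ≥0∞) : Set (ℕ × (Fin n → ℤ)) :=
  {c | cell a l c.1 c.2 ⊆ cube a l ∧ t * volume (cell a l c.1 c.2) < ∫⁻ x in cell a l c.1 c.2, g x ∧
    ∀ k m, k < c.1 → cell a l c.1 c.2 ⊆ cell a l k m →
      ∫⁻ x in cell a l k m, g x ≤ t * volume (cell a l k m)}

theorem cell_nonempty (a : Rn n) {l : ℝ} (hl : 0 < l) (k : ℕ) (m : Fin n → ℤ) :
    (cell a l k m).Nonempty :=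
  ⟨_, fun _ => ⟨le_rfl, lt_add_of_pos_right _ (by positivity)⟩⟩

/-- If two stopping cells of different generations met, the larger would be an ancestor of the
smaller with average above `t`, against the stopping rule. -/
theorem pairwiseDisjoint_stoppingCells (a : Rn n) {l : ℝ} (hl : 0 < l) (g : Rn n → ℝ≥0∞)
    (t : ℝ≥0∞) :
    (stoppingCells a l g t).PairwiseDisjoint fun c => cell a l c.1 c.2 := by
  have key : ∀ c ∈ stoppingCells a l g t, ∀ c' ∈ stoppingCells a l g t, c.1 < c'.1 →
      Disjoint (cell a l c.1 c.2) (cell a l c'.1 c'.2) := by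
    intro c hc c' hc' hlt
    rw [Set.disjoint_left]
    intro x hx hx'
    exact absurd (hc'.2.2 _ _ hlt (cell_subset_cell hl hlt.le hx hx')) (not_le.2 hc.2.1)
  rintro ⟨k, m⟩ hc ⟨k', m'⟩ hc' hne
  rcases lt_trichotomy k k' with h | h | h
  · exact key _ hc _ hc' h
  · subst h
    refine Set.disjoint_left.2 fun x hx hx' => hne (Prod.ext rfl ?_)
    exact cell_index_unique hl hx hx'
  · exact (key _ hc' _ hc h).symm

/-- The parent of a stopping cell has average at most `t` and volume `2 ^ n` times larger.
Generation zero has no parent; `h` rules it out. -/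
theorem setLIntegral_stoppingCell_le {a : Rn n} {l : ℝ} (hl : 0 < l) {g : Rn n → ℝ≥0∞}
    {t : ℝ≥0∞} (h : ∫⁻ x in cube a l, g x ≤ t * volume (cube a l)) {c : ℕ × (Fin n → ℤ)}
    (hc : c ∈ stoppingCells a l g t) :
    ∫⁻ x in cell a l c.1 c.2, g x ≤ 2 ^ n * t * volume (cell a l c.1 c.2) := by
  obtain ⟨k, m⟩ := c
  obtain ⟨x, hx⟩ := cell_nonempty a hl k m
  rcases k with _ | k
  · have : m = 0 := cell_index_unique hl hx (by rw [cell_zero]; exact hc.1 hx)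
    subst this
    have := hc.2.1
    rw [cell_zero] at this
    exact absurd h (not_le.2 this)
  · obtain ⟨m', hm'⟩ := exists_mem_cell a hl k x
    have hsub := cell_subset_cell hl k.le_succ hm' hx
    calc ∫⁻ x in cell a l (k + 1) m, g x ≤ ∫⁻ x in cell a l k m', g x := lintegral_mono_set hsub
      _ ≤ t * volume (cell a l k m') := hc.2.2 _ _ k.lt_succ_self hsub
      _ = _ := by rw [volume_cell_succ a l k m' m]; ring

/-- The first cell around `x` whose average exceeds `t` would be a stopping cell containing `x`. -/
theorem setLIntegral_cell_le_of_notMem {a : Rn n} {l : ℝ} (hl : 0 < l) {g : Rn n → ℝ≥0∞}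
    {t : ℝ≥0∞} {x : Rn n} (hx : x ∈ cube a l)
    (hx' : x ∉ ⋃ c ∈ stoppingCells a l g t, cell a l c.1 c.2) {k : ℕ} {m : Fin n → ℤ}
    (hm : x ∈ cell a l k m) :
    ∫⁻ x in cell a l k m, g x ≤ t * volume (cell a l k m) := by
  induction k using Nat.strong_induction_on generalizing m with
  | _ k ih =>
    by_contra! hcon
    refine hx' (Set.mem_biUnion (x := (k, m)) ⟨?_, hcon, ?_⟩ hm)
    · rw [← cell_zero] at hx ⊢
      exact cell_subset_cell hl (Nat.zero_le k) hx hm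
    · intro k' m' hk' hsub
      exact ih k' hk' (hsub hm)

/-- Lebesgue differentiation along shrinking cubes. -/
theorem ae_norm_sub_le_of_cube_averages {b : Rn n → ℝ} (hb : LocallyIntegrable b) :
    ∀ᵐ x, ∀ (c : ℝ) (t : ℝ≥0) (a : ℕ → Rn n) (l : ℕ → ℝ), (∀ k, 0 < l k) →
      Filter.Tendsto l Filter.atTop (nhds 0) → (∀ k, x ∈ cube (a k) (l k)) →
      (∀ k, ∫⁻ y in cube (a k) (l k), ‖b y - c‖ₑ ≤ t * volume (cube (a k) (l k))) →
      ‖b x - c‖ₑ ≤ t := by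
  obtain ⟨κ, hκ⟩ := exists_volume_closedBall_le n (√n + 1) (by positivity)
  filter_upwards [IsUnifLocDoublingMeasure.ae_tendsto_average_norm_sub volume hb 1]
    with x hx c t a l hl hl0 hxm hav
  have hs : (0 : ℝ) < √n + 1 := by positivity
  have hlim := hx (l := Filter.atTop) (fun _ : ℕ => x) (fun k => (√n + 1) * l k)
    (tendsto_nhdsWithin_iff.2 ⟨by simpa using hl0.const_mul (√n + 1),
      Filter.Eventually.of_forall fun k => by have := hl k; simp only [Set.mem_Ioi]; positivity⟩)
    (Filter.Eventually.of_forall fun k => by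
      have := hl k; simp only [one_mul]; exact Metric.mem_closedBall_self (by positivity))
  have hlim2 : Filter.Tendsto (fun k => κ * ENNReal.ofReal
      (⨍ y in Metric.closedBall x ((√n + 1) * l k), ‖b y - b x‖) + t) Filter.atTop
      (nhds (κ * ENNReal.ofReal 0 + t)) :=
    (ENNReal.Tendsto.const_mul (ENNReal.tendsto_ofReal hlim) (Or.inr (by simp))).add_const _
  have hb' : LocallyIntegrable (fun y => b y - b x) := hb.sub (locallyIntegrable_const _)
  have hfin : ∀ k, ‖b x - c‖ₑ ≤ κ * ENNReal.ofReal
      (⨍ y in Metric.closedBall x ((√n + 1) * l k), ‖b y - b x‖) + t := by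
    intro k
    set R := cube (a k) (l k)
    set B := Metric.closedBall x ((√n + 1) * l k)
    have hB : volume B ≠ ∞ := measure_closedBall_lt_top.ne
    have hB0 : volume B ≠ 0 := (Metric.measure_closedBall_pos _ _ (mul_pos hs (hl k))).ne'
    have hsub : R ⊆ B := cube_subset_closedBall _ (hl k) (hxm k)
    have hR0 : volume R ≠ 0 := volume_cube_ne_zero _ (hl k)
    have hR : volume R ≠ ∞ := volume_cube_ne_top _ _
    have hint : IntegrableOn (fun y => b y - b x) B :=
      hb'.integrableOn_isCompact (isCompact_closedBall _ _)
    have h1 : ∫⁻ y in B, ‖b y - b x‖ₑ = ENNReal.ofReal (⨍ y in B, ‖b y - b x‖) * volume B := by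
      rw [← ofReal_integral_norm_eq_lintegral_enorm hint, setAverage_eq, smul_eq_mul,
        ENNReal.ofReal_mul (by positivity), measureReal_def,
        ENNReal.ofReal_inv_of_pos (ENNReal.toReal_pos hB0 hB), ENNReal.ofReal_toReal hB, mul_comm,
        ← mul_assoc, ENNReal.mul_inv_cancel hB0 hB, one_mul]
    -- The triangle inequality is averaged over the cube `R`; the oscillation around `b x` is
    -- enlarged to the ball `B`, where Lebesgue differentiation along centred balls applies.
    have h2 : ‖b x - c‖ₑ * volume R ≤ (κ * ENNReal.ofReal (⨍ y in B, ‖b y - b x‖) + t) *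
        volume R := by
      calc ‖b x - c‖ₑ * volume R = ∫⁻ _ in R, ‖b x - c‖ₑ := by simp
        _ ≤ ∫⁻ y in R, (‖b y - b x‖ₑ + ‖b y - c‖ₑ) := by
            refine lintegral_mono fun y => ?_
            have : b x - c = -(b y - b x) + (b y - c) := by ring
            rw [this]
            exact (enorm_add_le _ _).trans (by rw [enorm_neg])
        _ = (∫⁻ y in R, ‖b y - b x‖ₑ) + ∫⁻ y in R, ‖b y - c‖ₑ :=
            lintegral_add_left' (hint.mono_set hsub).aestronglyMeasurable.enorm _
        _ ≤ ENNReal.ofReal (⨍ y in B, ‖b y - b x‖) * (κ * volume R) + t * volume R := by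
            refine add_le_add ?_ (hav k)
            refine (lintegral_mono_set hsub).trans (h1.le.trans ?_)
            gcongr
            exact hκ _ _ _ (hl k)
        _ = _ := by ring
    exact (ENNReal.mul_le_mul_iff_left hR0 hR).1 h2
  simpa using ge_of_tendsto' hlim2 hfin

end Cubes

/-! ### `A_∞` property and weighted John–Nirenberg inequality. -/

section AInfinity

variable {n : ℕ}

/-- A Muckenhoupt condition on cubes for `V`, with dual weight `S`, bounds the `V`-mass of small
subsets of cubes. -/
theorem exists_setLIntegral_le_of_cube_condition {V S : Rn n → ℝ≥0∞} (hV : Measurable V)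
    (hS : Measurable S) {x y : ℝ} (hx : 0 < x) (hy : 0 < y) (hxy : x + y = 1)
    (hVS : ∀ᵐ z, 1 ≤ V z ^ x * S z ^ y) {C : ℝ≥0}
    (hC : ∀ (a : Rn n) (l : ℝ), 0 < l →
      (∫⁻ z in cube a l, V z) ^ x * (∫⁻ z in cube a l, S z) ^ y ≤ C * volume (cube a l))
    (hfin : ∀ (a : Rn n) (l : ℝ), 0 < l → ∫⁻ z in cube a l, V z ≠ ∞) :
    ∃ ρ : ℝ≥0, ρ < 1 ∧ ∀ (a : Rn n) (l : ℝ), 0 < l → ∀ E ⊆ cube a l, MeasurableSet E →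
      4 * volume E ≤ volume (cube a l) →
      ∫⁻ z in E, V z ≤ ρ * ∫⁻ z in cube a l, V z := by
  -- The factor `(2 * C) ^ (1 / x)` is the ratio bound for the masses of the cube and of the
  -- complement `G` of `E`; adding `1` makes `1 - M⁻¹` a genuine difference in `ℝ≥0`.
  set M : ℝ≥0 := (2 * C) ^ (1 / x) + 1 with hM
  have hM1 : 1 ≤ M := by rw [hM]; exact le_add_self
  have hM0 : M ≠ 0 := (zero_lt_one.trans_le hM1).ne'
  refine ⟨1 - M⁻¹, tsub_lt_self one_pos (inv_pos.2 (zero_lt_one.trans_le hM1)), ?_⟩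
  intro a l hl E hE hEm hEs
  set Q := cube a l with hQ
  have hQm : MeasurableSet Q := measurableSet_cube a l
  have hvQ : volume Q ≠ ∞ := volume_cube_ne_top a l
  have hvQ0 : volume Q ≠ 0 := volume_cube_ne_zero a hl
  set G := Q \ E with hG
  have hGm : MeasurableSet G := hQm.diff hEm
  have hvE : volume E ≠ ∞ := measure_ne_top_of_subset hE hvQ
  have hvG : volume G ≠ ∞ := measure_ne_top_of_subset Set.sdiff_subset hvQ
  have hsplit : volume Q = volume E + volume G := by
    rw [hG, ← measure_inter_add_sdiff Q hEm, Set.inter_eq_right.2 hE]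
  have hGl : volume Q ≤ 2 * volume G := by
    rw [hsplit] at hEs ⊢
    lift volume E to ℝ≥0 using hvE with e
    lift volume G to ℝ≥0 using hvG with g
    norm_cast at hEs ⊢
    have h1 : (4 * e : ℝ) ≤ e + g := by exact_mod_cast hEs
    have h2 : (0 : ℝ) ≤ e := e.2
    have h3 : (0 : ℝ) ≤ g := g.2
    have : (e + g : ℝ) ≤ 2 * g := by linarith
    exact_mod_cast this
  have hol : volume G ≤ (∫⁻ z in G, V z) ^ x * (∫⁻ z in Q, S z) ^ y := by
    calc volume G = ∫⁻ _ in G, 1 := by simp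
      _ ≤ ∫⁻ z in G, V z ^ x * S z ^ y := lintegral_mono_ae (ae_restrict_of_ae hVS)
      _ ≤ (∫⁻ z in G, V z) ^ x * (∫⁻ z in G, S z) ^ y :=
          ENNReal.lintegral_mul_norm_pow_le hV.aemeasurable hS.aemeasurable hx.le hy.le hxy
      _ ≤ _ := by gcongr; exact Set.sdiff_subset
  -- Multiplying by `volume Q` and by the `V`-mass brings in the full Muckenhoupt product, so no
  -- division by the `S`-mass is needed.
  have h1 : (∫⁻ z in Q, V z) ^ x ≤ (2 * C : ℝ≥0) * (∫⁻ z in G, V z) ^ x := by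
    refine (ENNReal.mul_le_mul_iff_left hvQ0 hvQ).1 ?_
    calc (∫⁻ z in Q, V z) ^ x * volume Q
        ≤ (∫⁻ z in Q, V z) ^ x * (2 * ((∫⁻ z in G, V z) ^ x * (∫⁻ z in Q, S z) ^ y)) := by
          gcongr; exact hGl.trans (by gcongr)
      _ = 2 * (∫⁻ z in G, V z) ^ x * ((∫⁻ z in Q, V z) ^ x * (∫⁻ z in Q, S z) ^ y) := by ring
      _ ≤ 2 * (∫⁻ z in G, V z) ^ x * (C * volume Q) := mul_le_mul_right (hC a l hl) _
      _ = _ := by push_cast; ring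
  have h2 : ∫⁻ z in Q, V z ≤ M * ∫⁻ z in G, V z := by
    calc ∫⁻ z in Q, V z = ((∫⁻ z in Q, V z) ^ x) ^ (1 / x) := by
          rw [← ENNReal.rpow_mul, mul_one_div_cancel hx.ne', ENNReal.rpow_one]
      _ ≤ ((2 * C : ℝ≥0) * (∫⁻ z in G, V z) ^ x) ^ (1 / x) := by gcongr
      _ = ((2 * C) ^ (1 / x) : ℝ≥0) * ∫⁻ z in G, V z := by
          rw [ENNReal.mul_rpow_of_nonneg _ _ (by positivity), ← ENNReal.rpow_mul,
            mul_one_div_cancel hx.ne', ENNReal.rpow_one,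
            ENNReal.coe_rpow_of_nonneg _ (by positivity)]
      _ ≤ _ := by gcongr; rw [hM]; exact le_self_add
  have hsV : ∫⁻ z in Q, V z = (∫⁻ z in E, V z) + ∫⁻ z in G, V z := by
    rw [hG, ← lintegral_inter_add_sdiff V Q hEm, Set.inter_eq_right.2 hE]
  have hfQ := hfin a l hl
  rw [← hQ, hsV] at hfQ
  rw [hsV] at h2 ⊢
  have hfE := (ENNReal.add_ne_top.1 hfQ).1
  have hfG := (ENNReal.add_ne_top.1 hfQ).2
  lift (∫⁻ z in E, V z) to ℝ≥0 using hfE with e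
  lift (∫⁻ z in G, V z) to ℝ≥0 using hfG with g
  norm_cast at h2 ⊢
  have h2' : (e + g : ℝ) ≤ M * g := by exact_mod_cast h2
  have hMi : M⁻¹ ≤ 1 := inv_le_one_of_one_le₀ hM1
  rw [← NNReal.coe_le_coe, NNReal.coe_mul, NNReal.coe_sub hMi]
  push_cast
  have hMp : (0 : ℝ) < M := by exact_mod_cast zero_lt_one.trans_le hM1
  have : (M : ℝ)⁻¹ * (e + g) ≤ g := by rw [inv_mul_le_iff₀ hMp]; exact h2'
  linarith

variable {V : Rn n → ℝ≥0∞} {ρ : ℝ≥0} {b : Rn n → ℝ} {c : Rn n → ℝ → ℝ} {K : ℝ≥0}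

/-- Geometric decay of the oscillation of a function of bounded mean oscillation, measured by a
density satisfying an `A_∞` condition. -/
theorem setLIntegral_oscillation_le_pow
    (hA : ∀ (a : Rn n) (l : ℝ), 0 < l → ∀ E ⊆ cube a l, MeasurableSet E →
      4 * volume E ≤ volume (cube a l) → ∫⁻ z in E, V z ≤ ρ * ∫⁻ z in cube a l, V z)
    (hbm : Measurable b) (hbi : LocallyIntegrable b) (hK : 0 < K)
    (hbK : ∀ (a : Rn n) (l : ℝ), 0 < l →
      ∫⁻ z in cube a l, ‖b z - c a l‖ₑ ≤ K * volume (cube a l))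
    (k : ℕ) (a : Rn n) {l : ℝ} (hl : 0 < l) :
    ∫⁻ z in cube a l ∩ {z | (k * (K + 2 ^ n * (4 * K)) : ℝ≥0) ≤ ‖b z - c a l‖ₑ}, V z ≤
      (ρ ^ k : ℝ≥0) * ∫⁻ z in cube a l, V z := by
  induction k generalizing a l with
  | zero => simp
  | succ k ih =>
    -- `L` bounds the jump of the constant `c` from the cube to a stopping cell: `K` is the
    -- oscillation inside the cell, and `2 ^ n * (4 * K)` bounds the average of `g` over it.
    set L : ℝ≥0 := K + 2 ^ n * (4 * K) with hL
    set g : Rn n → ℝ≥0∞ := fun z => ‖b z - c a l‖ₑ with hg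
    have hgm : Measurable g := (hbm.sub_const _).enorm
    set J := stoppingCells a l g (4 * K : ℝ≥0) with hJ
    have hJc : J.Countable := J.to_countable
    set U := ⋃ i ∈ J, cell a l i.1 i.2 with hU
    have hcm : ∀ i ∈ J, MeasurableSet (cell a l i.1 i.2) := fun i _ => measurableSet_cube _ _
    have hdisj := pairwiseDisjoint_stoppingCells a hl g (4 * K : ℝ≥0)
    have hUm : MeasurableSet U := .biUnion hJc hcm
    have hUQ : U ⊆ cube a l := Set.iUnion₂_subset fun i hi => hi.1
    have h0 : ∫⁻ z in cube a l, g z ≤ (4 * K : ℝ≥0) * volume (cube a l) := by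
      refine (hbK a l hl).trans ?_
      gcongr
      exact le_mul_of_one_le_left' (by norm_num)
    -- The height `4 * K` is chosen for this: Chebyshev's inequality leaves the stopping cells at
    -- most a quarter of the cube, as `hA` requires.
    have hUs : 4 * volume U ≤ volume (cube a l) := by
      have hK' : (K : ℝ≥0∞) ≠ 0 := by simpa using hK.ne'
      refine (ENNReal.mul_le_mul_iff_right hK' ENNReal.coe_ne_top).1 ?_
      calc (K : ℝ≥0∞) * (4 * volume U) = (4 * K : ℝ≥0) * volume U := by push_cast; ring
        _ = ∑' i : J, (4 * K : ℝ≥0) * volume (cell a l i.1.1 i.1.2) := by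
            rw [hU, measure_biUnion hJc hdisj hcm, ENNReal.tsum_mul_left]
        _ ≤ ∑' i : J, ∫⁻ z in cell a l i.1.1 i.1.2, g z :=
            ENNReal.tsum_le_tsum fun i => i.2.2.1.le
        _ = ∫⁻ z in U, g z := by rw [hU, lintegral_biUnion hJc hcm hdisj]
        _ ≤ ∫⁻ z in cube a l, g z := lintegral_mono_set hUQ
        _ ≤ _ := hbK a l hl
    have hoff : ∀ᵐ z, z ∈ cube a l → z ∉ U → g z ≤ (4 * K : ℝ≥0) := by
      filter_upwards [ae_norm_sub_le_of_cube_averages hbi] with z hz hzQ hzU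
      choose m hm using fun k => exists_mem_cell a hl k z
      refine hz (c a l) (4 * K) _ (fun k => l / 2 ^ k) (fun k => by positivity) ?_ hm
        fun k => setLIntegral_cell_le_of_notMem hl hzQ hzU (hm k)
      have := (tendsto_pow_atTop_nhds_zero_of_lt_one (r := (1 / 2 : ℝ)) (by norm_num)
        (by norm_num)).const_mul l
      simpa [div_eq_mul_inv] using this
    have hin : ∀ i ∈ J, ∀ z, ((k + 1 : ℕ) * L : ℝ≥0) ≤ g z → (k * L : ℝ≥0) ≤
        ‖b z - c (a + WithLp.toLp 2 fun j => i.2 j * (l / 2 ^ i.1)) (l / 2 ^ i.1)‖ₑ := by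
      intro i hi z hz
      set R := cell a l i.1 i.2 with hR
      set c' := c (a + WithLp.toLp 2 fun j => i.2 j * (l / 2 ^ i.1)) (l / 2 ^ i.1)
      have hl' : 0 < l / 2 ^ i.1 := by positivity
      have hdiff : ‖c' - c a l‖ₑ ≤ L := by
        have hR0 : volume R ≠ 0 := volume_cube_ne_zero _ hl'
        refine (ENNReal.mul_le_mul_iff_left hR0 (volume_cube_ne_top _ _)).1 ?_
        calc ‖c' - c a l‖ₑ * volume R = ∫⁻ _ in R, ‖c' - c a l‖ₑ := by simp
          _ ≤ ∫⁻ z in R, (‖b z - c'‖ₑ + g z) := by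
              refine lintegral_mono fun z => ?_
              have : c' - c a l = -(b z - c') + (b z - c a l) := by ring
              rw [this]
              exact (enorm_add_le _ _).trans (by rw [enorm_neg])
          _ = (∫⁻ z in R, ‖b z - c'‖ₑ) + ∫⁻ z in R, g z := lintegral_add_right _ hgm
          _ ≤ K * volume R + 2 ^ n * (4 * K : ℝ≥0) * volume R :=
              add_le_add (hbK _ _ hl') (setLIntegral_stoppingCell_le hl h0 hi)
          _ = _ := by rw [hL]; push_cast; ring
      have h1 : g z ≤ ‖b z - c'‖ₑ + L := by
        have : b z - c a l = (b z - c') + (c' - c a l) := by ring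
        simp only [hg, this]
        exact (enorm_add_le _ _).trans (by gcongr)
      have h2 := hz.trans h1
      rw [show (((k + 1 : ℕ) * L : ℝ≥0) : ℝ≥0∞) = (k * L : ℝ≥0) + (L : ℝ≥0∞) by
        push_cast; ring] at h2
      exact (ENNReal.add_le_add_iff_right ENNReal.coe_ne_top).1 h2
    have hlt : (4 * K : ℝ≥0) < ((k + 1 : ℕ) * L : ℝ≥0) := by
      have h1 : (1 : ℝ≥0) ≤ 2 ^ n := one_le_pow₀ (by norm_num)
      calc 4 * K < K + 4 * K := lt_add_of_pos_left _ hK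
        _ ≤ L := by rw [hL]; exact add_le_add_right (le_mul_of_one_le_left' h1) _
        _ ≤ _ := le_mul_of_one_le_left' (by simp)
    -- Off the stopping cells `g ≤ 4 * K < (k + 1) * L` almost everywhere. Inside one, changing the
    -- constant costs one `L`, so the inductive hypothesis applies to the cell, and `hA` supplies
    -- one more factor `ρ`.
    have hsub : (cube a l ∩ {z | ((k + 1 : ℕ) * L : ℝ≥0) ≤ g z} : Set (Rn n)) ≤ᵐ[volume]
        (⋃ i ∈ J, cell a l i.1 i.2 ∩ {z | (k * L : ℝ≥0) ≤
          ‖b z - c (a + WithLp.toLp 2 fun j => i.2 j * (l / 2 ^ i.1)) (l / 2 ^ i.1)‖ₑ} :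
          Set (Rn n)) := by
      filter_upwards [hoff] with z hz hz'
      by_cases hzU : z ∈ U
      · obtain ⟨i, hi, hzi⟩ := Set.mem_iUnion₂.1 hzU
        exact Set.mem_iUnion₂.2 ⟨i, hi, hzi, hin i hi z hz'.2⟩
      · exact absurd (hz'.2.trans (hz hz'.1 hzU)) (not_le.2 (by exact_mod_cast hlt))
    calc _ ≤ ∫⁻ z in ⋃ i ∈ J, cell a l i.1 i.2 ∩ {z | (k * L : ℝ≥0) ≤
            ‖b z - c (a + WithLp.toLp 2 fun j => i.2 j * (l / 2 ^ i.1)) (l / 2 ^ i.1)‖ₑ}, V z :=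
          lintegral_mono' (Measure.restrict_mono_ae hsub) le_rfl
      _ ≤ ∑' i : J, ∫⁻ z in cell a l i.1.1 i.1.2 ∩ {z | (k * L : ℝ≥0) ≤
            ‖b z - c (a + WithLp.toLp 2 fun j => i.1.2 j * (l / 2 ^ i.1.1)) (l / 2 ^ i.1.1)‖ₑ},
            V z := by
          rw [Set.biUnion_eq_iUnion]
          exact lintegral_iUnion_le _ _
      _ ≤ ∑' i : J, (ρ ^ k : ℝ≥0) * ∫⁻ z in cell a l i.1.1 i.1.2, V z :=
          ENNReal.tsum_le_tsum fun i => ih _ (by positivity)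
      _ = (ρ ^ k : ℝ≥0) * ∫⁻ z in U, V z := by
          rw [ENNReal.tsum_mul_left, hU, lintegral_biUnion hJc hcm hdisj]
      _ ≤ (ρ ^ k : ℝ≥0) * (ρ * ∫⁻ z in cube a l, V z) := by
          gcongr
          exact hA a l hl U hUQ hUm hUs
      _ = _ := by rw [pow_succ]; push_cast; ring

/-- The John–Nirenberg inequality with respect to a density satisfying an `A_∞` condition. -/
theorem exists_exp_oscillation_le (hVm : Measurable V) (hρ : ρ < 1)
    (hA : ∀ (a : Rn n) (l : ℝ), 0 < l → ∀ E ⊆ cube a l, MeasurableSet E →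
      4 * volume E ≤ volume (cube a l) → ∫⁻ z in E, V z ≤ ρ * ∫⁻ z in cube a l, V z)
    (hbm : Measurable b) (hbi : LocallyIntegrable b) (hK : 0 < K)
    (hbK : ∀ (a : Rn n) (l : ℝ), 0 < l →
      ∫⁻ z in cube a l, ‖b z - c a l‖ₑ ≤ K * volume (cube a l)) :
    ∃ ε : ℝ, 0 < ε ∧ ∃ C : ℝ≥0, ∀ (a : Rn n) (l : ℝ), 0 < l →
      ∫⁻ z in cube a l, ENNReal.ofReal (Real.exp (ε * |b z - c a l|)) * V z ≤
        C * ∫⁻ z in cube a l, V z := by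
  set L : ℝ≥0 := K + 2 ^ n * (4 * K) with hL
  have hLp : 0 < L := by positivity
  have hLr : (0 : ℝ) < L := by exact_mod_cast hLp
  -- The growth of the exponential over one step of length `L` must be beaten by the decay `ρ`, so
  -- that the sum over level sets is geometric.
  obtain ⟨ε, hερ, hε⟩ : ∃ ε : ℝ, Real.exp (ε * L) * ρ < 1 ∧ 0 < ε := by
    have h1 : Filter.Tendsto (fun ε : ℝ => Real.exp (ε * L) * ρ) (nhdsWithin 0 (Set.Ioi 0))
        (nhds (Real.exp (0 * L) * ρ)) :=
      (Continuous.tendsto (by fun_prop) 0).mono_left nhdsWithin_le_nhds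
    have h2 : Real.exp (0 * L) * ρ < 1 := by simpa using hρ
    exact ((h1.eventually (eventually_lt_nhds h2)).and self_mem_nhdsWithin).exists
  set r : ℝ≥0 := (Real.exp (ε * L)).toNNReal with hr
  have hrρ : r * ρ < 1 := by
    rw [← NNReal.coe_lt_coe]; push_cast
    rwa [hr, Real.coe_toNNReal _ (Real.exp_pos _).le]
  have hsum : ∑' k : ℕ, ((r ^ (k + 1) * ρ ^ k : ℝ≥0) : ℝ≥0∞) ≠ ∞ := by
    rw [ENNReal.tsum_coe_ne_top_iff_summable]
    have := (NNReal.summable_geometric hrρ).mul_left r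
    refine this.congr fun k => ?_
    rw [mul_pow, pow_succ]; ring
  refine ⟨ε, hε, (∑' k : ℕ, ((r ^ (k + 1) * ρ ^ k : ℝ≥0) : ℝ≥0∞)).toNNReal, fun a l hl => ?_⟩
  rw [ENNReal.coe_toNNReal hsum]
  set A : ℕ → Set (Rn n) := fun k => {z | (k * L : ℝ≥0) ≤ ‖b z - c a l‖ₑ} with hAd
  have hAm : ∀ k, MeasurableSet (A k) := fun k =>
    measurableSet_le measurable_const (hbm.sub_const _).enorm
  have hpt : ∀ z, ENNReal.ofReal (Real.exp (ε * |b z - c a l|)) * V z ≤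
      ∑' k : ℕ, ((r ^ (k + 1) : ℝ≥0) : ℝ≥0∞) * (A k).indicator V z := by
    intro z
    set t := |b z - c a l| with ht
    have ht0 : 0 ≤ t := abs_nonneg _
    set k := ⌊t / L⌋₊ with hk
    have hk1 : k * L ≤ t := by
      have := Nat.floor_le (div_nonneg ht0 hLr.le)
      rwa [le_div_iff₀ hLr] at this
    have hk2 : t < (k + 1) * L := by
      have := Nat.lt_floor_add_one (t / L)
      rwa [div_lt_iff₀ hLr] at this
    have hz : z ∈ A k := by
      change ((k * L : ℝ≥0) : ℝ≥0∞) ≤ ‖b z - c a l‖ₑ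
      rw [← ofReal_norm, Real.norm_eq_abs, ← ht, ← ENNReal.ofReal_coe_nnreal]
      exact ENNReal.ofReal_le_ofReal (by push_cast; exact hk1)
    refine le_trans ?_ (ENNReal.le_tsum k)
    rw [Set.indicator_of_mem hz]
    gcongr
    rw [← ENNReal.ofReal_coe_nnreal]
    refine ENNReal.ofReal_le_ofReal ?_
    rw [NNReal.coe_pow, hr, Real.coe_toNNReal _ (Real.exp_pos _).le, ← Real.exp_nat_mul]
    apply Real.exp_le_exp.2
    push_cast
    nlinarith
  calc _ ≤ ∫⁻ z in cube a l, ∑' k : ℕ, ((r ^ (k + 1) : ℝ≥0) : ℝ≥0∞) * (A k).indicator V z :=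
        lintegral_mono hpt
    _ = ∑' k : ℕ, ((r ^ (k + 1) : ℝ≥0) : ℝ≥0∞) * ∫⁻ z in cube a l ∩ A k, V z := by
        rw [lintegral_tsum fun k => ((hVm.indicator (hAm k)).const_mul _).aemeasurable]
        refine tsum_congr fun k => ?_
        rw [lintegral_const_mul _ (hVm.indicator (hAm k)), lintegral_indicator (hAm k),
          Measure.restrict_restrict (hAm k), Set.inter_comm]
    _ ≤ ∑' k : ℕ, ((r ^ (k + 1) : ℝ≥0) : ℝ≥0∞) * ((ρ ^ k : ℝ≥0) * ∫⁻ z in cube a l, V z) := by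
        gcongr with k
        exact setLIntegral_oscillation_le_pow hA hbm hbi hK hbK k a hl
    _ = _ := by
        rw [← ENNReal.tsum_mul_right]
        refine tsum_congr fun k => ?_
        push_cast; ring

end AInfinity

/-! ### Stability of the weight classes under small exponentials. -/

section MuckenhouptWheeden

variable {n : ℕ}

/-- Raising to the power `h` makes the total exponent one, so the two normalising volumes merge into
a single `m`. In this form the condition passes easily between balls and cubes. -/
theorem rpow_div_mul_rpow_div_le_iff {P Q h : ℝ} (hP : 0 < P) (hQ : 0 < Q) (hh : 0 < h)
    (hPQ : h / Q + h / P = 1) {I J m C : ℝ≥0∞} (hm0 : m ≠ 0) (hm : m ≠ ∞) :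
    (I / m) ^ (1 / Q) * (J / m) ^ (1 / P) ≤ C ↔ I ^ (h / Q) * J ^ (h / P) ≤ C ^ h * m := by
  have e : ((I / m) ^ (1 / Q) * (J / m) ^ (1 / P)) ^ h = I ^ (h / Q) * J ^ (h / P) / m := by
    rw [ENNReal.mul_rpow_of_nonneg _ _ hh.le, ← ENNReal.rpow_mul, ← ENNReal.rpow_mul,
      one_div_mul_eq_div, one_div_mul_eq_div, ENNReal.div_rpow_of_nonneg _ _ (by positivity),
      ENNReal.div_rpow_of_nonneg _ _ (by positivity)]
    conv_rhs => rw [← ENNReal.rpow_one m, ← hPQ, ENNReal.rpow_add _ _ hm0 hm]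
    have hc : m ^ (h / Q) ≠ 0 := by simp [hm0, hm]
    have hd : m ^ (h / Q) ≠ ∞ := by simp [hm0, hm]
    generalize m ^ (h / Q) = c at hc hd
    simp only [div_eq_mul_inv _ c, div_eq_mul_inv _ (m ^ (h / P)), div_eq_mul_inv _ (c * _)]
    rw [ENNReal.mul_inv (Or.inl hc) (Or.inl hd)]
    ring
  rw [← ENNReal.rpow_le_rpow_iff hh, e, ENNReal.div_le_iff hm0 hm]

/-- Multiplying a Muckenhoupt–Wheeden weight by a small power of the exponential of a function of
bounded mean oscillation stays within the class. -/
theorem MemApq.exists_mul_exp {P Q : ℝ} (hP : 1 < P) (hQ : 0 < Q) {u : Rn n → ℝ≥0}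
    (hu : MemApq P Q u) {b : Rn n → ℝ} (hbm : Measurable b) (hbi : LocallyIntegrable b)
    {K : ℝ≥0} (hK : 0 < K) {c : Rn n → ℝ → ℝ}
    (hbK : ∀ (a : Rn n) (l : ℝ), 0 < l →
      ∫⁻ z in cube a l, ‖b z - c a l‖ₑ ≤ K * volume (cube a l)) :
    ∃ ε₀ : ℝ, 0 < ε₀ ∧ ∀ ε : ℝ, |ε| ≤ ε₀ →
      MemApq P Q (fun x => u x * (Real.exp (ε * b x)).toNNReal) := by
  obtain ⟨⟨hum, hupos⟩, C, hC⟩ := hu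
  set θ := P / (P - 1) with hθd
  have hθ : 0 < θ := div_pos (by linarith) (by linarith)
  -- `h` is fixed by `1 / h = 1 / Q + 1 / θ`, which makes `h / Q` and `h / θ` conjugate Hölder
  -- weights.
  set h := Q * θ / (Q + θ) with hhd
  have hh : 0 < h := by positivity
  have hx : 0 < h / Q := by positivity
  have hy : 0 < h / θ := by positivity
  have hxy : h / Q + h / θ = 1 := by rw [hhd]; field_simp; ring
  set V : Rn n → ℝ≥0∞ := fun z => (u z : ℝ≥0∞) ^ Q with hV
  set S : Rn n → ℝ≥0∞ := fun z => (u z : ℝ≥0∞) ^ (-θ) with hS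
  have hVm : Measurable V := hum.coe_nnreal_ennreal.pow_const _
  have hSm : Measurable S := hum.coe_nnreal_ennreal.pow_const _
  obtain ⟨κ, hκ⟩ := exists_ball_supset_cube n
  obtain ⟨κ', hκ'⟩ := exists_cube_supset_ball n
  have hcube : ∀ (a : Rn n) (l : ℝ), 0 < l → (∫⁻ z in cube a l, V z) ^ (h / Q) *
      (∫⁻ z in cube a l, S z) ^ (h / θ) ≤ (C ^ h * κ : ℝ≥0) * volume (cube a l) := by
    intro a l hl
    obtain ⟨x, r, hr, hsub, hvol⟩ := hκ a l hl
    have h1 := hC x r hr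
    rw [setLAverage_eq, setLAverage_eq, rpow_div_mul_rpow_div_le_iff hθ hQ hh hxy
      (Metric.measure_ball_pos _ _ hr).ne' measure_ball_lt_top.ne] at h1
    calc _ ≤ (∫⁻ z in Metric.ball x r, V z) ^ (h / Q) *
          (∫⁻ z in Metric.ball x r, S z) ^ (h / θ) := by gcongr
      _ ≤ C ^ h * volume (Metric.ball x r) := h1
      _ ≤ C ^ h * (κ * volume (cube a l)) := by gcongr
      _ = _ := by rw [ENNReal.coe_mul, ENNReal.coe_rpow_of_nonneg _ hh.le, mul_assoc]
  have hVS : ∀ᵐ z, 1 ≤ V z ^ (h / Q) * S z ^ (h / θ) := by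
    filter_upwards [hupos] with z hz
    simp only [hV, hS]
    rw [← ENNReal.rpow_mul, ← ENNReal.rpow_mul, ← ENNReal.rpow_add _ _ (by simpa using hz.ne')
      ENNReal.coe_ne_top, show Q * (h / Q) + -θ * (h / θ) = 0 by field_simp; ring,
      ENNReal.rpow_zero]
  have hposV : ∀ (a : Rn n) (l : ℝ), 0 < l → ∫⁻ z in cube a l, V z ≠ 0 := by
    intro a l hl
    refine (setLIntegral_pos_iff hVm).2 ?_ |>.ne'
    have : (Function.support V ∩ cube a l : Set (Rn n)) =ᵐ[volume] cube a l := by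
      filter_upwards [hupos] with z hz
      refine propext ⟨fun h => h.2, fun h => ⟨?_, h⟩⟩
      simp [hV, hz.ne']
    rw [measure_congr this]
    exact (volume_cube_ne_zero a hl).bot_lt
  have hposS : ∀ (a : Rn n) (l : ℝ), 0 < l → ∫⁻ z in cube a l, S z ≠ 0 := by
    intro a l hl
    refine (setLIntegral_pos_iff hSm).2 ?_ |>.ne'
    have : (Function.support S ∩ cube a l : Set (Rn n)) = cube a l := by
      refine Set.inter_eq_right.2 fun z _ => ?_
      simp [hS, hθ.not_gt]
    rw [this]
    exact (volume_cube_ne_zero a hl).bot_lt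
  -- A bounded product in `[0, ∞]` with one factor nonzero forces the other to be finite.
  have hfinV : ∀ (a : Rn n) (l : ℝ), 0 < l → ∫⁻ z in cube a l, V z ≠ ∞ := by
    intro a l hl htop
    have := hcube a l hl
    rw [htop, ENNReal.top_rpow_of_pos hx, ENNReal.top_mul, top_le_iff] at this
    · exact ENNReal.mul_ne_top ENNReal.coe_ne_top (volume_cube_ne_top _ _) this
    · simp [hposS a l hl, hy.not_gt]
  have hfinS : ∀ (a : Rn n) (l : ℝ), 0 < l → ∫⁻ z in cube a l, S z ≠ ∞ := by
    intro a l hl htop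
    have := hcube a l hl
    rw [htop, ENNReal.top_rpow_of_pos hy, ENNReal.mul_top, top_le_iff] at this
    · exact ENNReal.mul_ne_top ENNReal.coe_ne_top (volume_cube_ne_top _ _) this
    · simp [hposV a l hl, hx.not_gt]
  obtain ⟨ρ₁, hρ₁, hA₁⟩ := exists_setLIntegral_le_of_cube_condition hVm hSm hx hy hxy hVS
    hcube hfinV
  obtain ⟨ρ₂, hρ₂, hA₂⟩ := exists_setLIntegral_le_of_cube_condition hSm hVm hy hx
    (by rw [add_comm]; exact hxy) (by simpa only [mul_comm] using hVS)
    (C := C ^ h * κ) (fun a l hl => by rw [mul_comm]; exact hcube a l hl) hfinS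
  obtain ⟨ε₁, hε₁, C₁, hC₁⟩ := exists_exp_oscillation_le hVm hρ₁ hA₁ hbm hbi hK hbK
  obtain ⟨ε₂, hε₂, C₂, hC₂⟩ := exists_exp_oscillation_le hSm hρ₂ hA₂ hbm hbi hK hbK
  refine ⟨min (ε₁ / Q) (ε₂ / θ), by positivity, fun ε hε => ?_⟩
  have hεQ : |ε| * Q ≤ ε₁ := by rw [← le_div_iff₀ hQ]; exact hε.trans (min_le_left _ _)
  have hεθ : |ε| * θ ≤ ε₂ := by rw [← le_div_iff₀ hθ]; exact hε.trans (min_le_right _ _)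
  refine ⟨⟨by fun_prop, ?_⟩, ?_⟩
  · filter_upwards [hupos] with z hz
    exact mul_pos hz (by simpa using Real.exp_pos _)
  have hpow : ∀ (z : Rn n) (t : ℝ), ((u z * (Real.exp (ε * b z)).toNNReal : ℝ≥0) : ℝ≥0∞) ^ t =
      ENNReal.ofReal (Real.exp (ε * t * b z)) * (u z : ℝ≥0∞) ^ t := by
    intro z t
    rw [ENNReal.coe_mul, ENNReal.mul_rpow_of_ne_top ENNReal.coe_ne_top ENNReal.coe_ne_top,
      mul_comm]
    congr 1
    change ENNReal.ofReal _ ^ t = _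
    rw [ENNReal.ofReal_rpow_of_pos (Real.exp_pos _), ← Real.exp_mul]
    congr 2; ring
  -- The exponential of `ε * t * b` is split at the local constant `c a l`; only the oscillation
  -- part is integrated.
  have hbd : ∀ (F : Rn n → ℝ≥0∞) (t δ : ℝ) (D : ℝ≥0), |ε * t| ≤ δ → (∀ (a : Rn n) (l : ℝ), 0 < l →
      ∫⁻ z in cube a l, ENNReal.ofReal (Real.exp (δ * |b z - c a l|)) * F z ≤
        D * ∫⁻ z in cube a l, F z) → ∀ (a : Rn n) (l : ℝ), 0 < l →
      ∫⁻ z in cube a l, ENNReal.ofReal (Real.exp (ε * t * b z)) * F z ≤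
        ENNReal.ofReal (Real.exp (ε * t * c a l)) * (D * ∫⁻ z in cube a l, F z) := by
    intro F t δ D hδ hF a l hl
    refine le_trans ?_ (mul_le_mul_right (hF a l hl) _)
    rw [← lintegral_const_mul' _ _ ENNReal.ofReal_ne_top]
    refine lintegral_mono fun z => ?_
    rw [← mul_assoc, ← ENNReal.ofReal_mul (Real.exp_pos _).le, ← Real.exp_add]
    gcongr
    have h1 : ε * t * (b z - c a l) ≤ δ * |b z - c a l| := by
      refine (le_abs_self _).trans ?_
      rw [abs_mul]; gcongr
    linarith
  have hcube' : ∀ (a : Rn n) (l : ℝ), 0 < l →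
      (∫⁻ z in cube a l, ((u z * (Real.exp (ε * b z)).toNNReal : ℝ≥0) : ℝ≥0∞) ^ Q) ^ (h / Q) *
      (∫⁻ z in cube a l, ((u z * (Real.exp (ε * b z)).toNNReal : ℝ≥0) : ℝ≥0∞) ^ (-θ)) ^ (h / θ) ≤
      (C₁ ^ (h / Q) * C₂ ^ (h / θ) * (C ^ h * κ) : ℝ≥0) * volume (cube a l) := by
    intro a l hl
    simp_rw [hpow]
    have hv := hbd V Q ε₁ C₁ (by rw [abs_mul, abs_of_pos hQ]; exact hεQ) hC₁ a l hl
    have hs := hbd S (-θ) ε₂ C₂ (by rw [abs_mul, abs_neg, abs_of_pos hθ]; exact hεθ) hC₂ a l hl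
    calc _ ≤ (ENNReal.ofReal (Real.exp (ε * Q * c a l)) * (C₁ * ∫⁻ z in cube a l, V z)) ^ (h / Q) *
          (ENNReal.ofReal (Real.exp (ε * (-θ) * c a l)) *
            (C₂ * ∫⁻ z in cube a l, S z)) ^ (h / θ) := by gcongr
      _ = (ENNReal.ofReal (Real.exp (ε * Q * c a l)) ^ (h / Q) *
          ENNReal.ofReal (Real.exp (ε * (-θ) * c a l)) ^ (h / θ)) *
          ((C₁ : ℝ≥0∞) ^ (h / Q) * (C₂ : ℝ≥0∞) ^ (h / θ)) *
          ((∫⁻ z in cube a l, V z) ^ (h / Q) * (∫⁻ z in cube a l, S z) ^ (h / θ)) := by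
          simp_rw [ENNReal.mul_rpow_of_nonneg _ _ hx.le, ENNReal.mul_rpow_of_nonneg _ _ hy.le]
          ring
      -- The local constants disappear: their exponents are `ε * h * c` and `-ε * h * c`.
      _ = ((C₁ : ℝ≥0∞) ^ (h / Q) * (C₂ : ℝ≥0∞) ^ (h / θ)) *
          ((∫⁻ z in cube a l, V z) ^ (h / Q) * (∫⁻ z in cube a l, S z) ^ (h / θ)) := by
          rw [ENNReal.ofReal_rpow_of_pos (Real.exp_pos _), ENNReal.ofReal_rpow_of_pos
            (Real.exp_pos _), ← ENNReal.ofReal_mul (by positivity), ← Real.exp_mul, ← Real.exp_mul,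
            ← Real.exp_add, show ε * Q * c a l * (h / Q) + ε * -θ * c a l * (h / θ) = 0 by
              field_simp; ring]
          simp
      _ ≤ ((C₁ : ℝ≥0∞) ^ (h / Q) * (C₂ : ℝ≥0∞) ^ (h / θ)) *
          ((C ^ h * κ : ℝ≥0) * volume (cube a l)) := mul_le_mul_right (hcube a l hl) _
      _ = _ := by
          rw [← ENNReal.coe_rpow_of_nonneg _ hx.le, ← ENNReal.coe_rpow_of_nonneg _ hy.le]
          push_cast; ring
  set D : ℝ≥0 := C₁ ^ (h / Q) * C₂ ^ (h / θ) * (C ^ h * κ)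
  clear_value D
  refine ⟨(D * κ') ^ (1 / h), fun x r hr => ?_⟩
  obtain ⟨a, l, hl, hsub, hvol⟩ := hκ' x r hr
  rw [setLAverage_eq, setLAverage_eq, rpow_div_mul_rpow_div_le_iff hθ hQ hh hxy
      (Metric.measure_ball_pos _ _ hr).ne' measure_ball_lt_top.ne,
      ENNReal.coe_rpow_of_nonneg _ (by positivity), ← ENNReal.rpow_mul, one_div_mul_cancel hh.ne',
      ENNReal.rpow_one]
  refine le_trans ?_ ((hcube' a l hl).trans ?_)
  · gcongr
  · rw [ENNReal.coe_mul, mul_assoc]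
    exact mul_le_mul_right hvol _

/-- A real Lipschitz image of a `BMO` function has bounded mean oscillation over cubes. -/
theorem MemBMO.exists_cube_oscillation_le {b : L0 n} (hb : MemBMO b) {φ : ℂ → ℝ}
    (hφ : ∀ z w, |φ z - φ w| ≤ ‖z - w‖) :
    ∃ K : ℝ≥0, 0 < K ∧ ∃ c : Rn n → ℝ → ℝ, ∀ (a : Rn n) (l : ℝ), 0 < l →
      ∫⁻ z in cube a l, ‖φ (b z) - c a l‖ₑ ≤ K * volume (cube a l) := by
  obtain ⟨hbi, C, hC⟩ := hb
  obtain ⟨κ, hκ⟩ := exists_ball_supset_cube n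
  -- The summand `1` only serves to make the constant positive, as the stopping heights require.
  refine ⟨C.toNNReal * κ + 1, by positivity, ?_⟩
  have key : ∀ (a : Rn n) (l : ℝ), ∃ c : ℝ, 0 < l →
      ∫⁻ z in cube a l, ‖φ (b z) - c‖ₑ ≤ (C.toNNReal * κ + 1 : ℝ≥0) * volume (cube a l) := by
    intro a l
    by_cases hl : 0 < l
    swap
    · exact ⟨0, fun h => absurd h hl⟩
    obtain ⟨x, r, hr, hsub, hvol⟩ := hκ a l hl
    set B := Metric.ball x r
    have hB : volume B ≠ ∞ := measure_ball_lt_top.ne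
    have hB0 : volume B ≠ 0 := (Metric.measure_ball_pos _ _ hr).ne'
    set m := ⨍ z in B, b z with hm
    refine ⟨φ m, fun _ => ?_⟩
    have hint : IntegrableOn (fun y => b y - m) B :=
      ((hbi.integrableOn_isCompact (isCompact_closedBall x r)).mono_set
        Metric.ball_subset_closedBall).sub (integrableOn_const hB)
    have h1 : ∫⁻ y in B, ‖b y - m‖ₑ = ENNReal.ofReal (⨍ y in B, ‖b y - m‖) * volume B := by
      rw [← ofReal_integral_norm_eq_lintegral_enorm hint, setAverage_eq, smul_eq_mul,
        ENNReal.ofReal_mul (by positivity), measureReal_def,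
        ENNReal.ofReal_inv_of_pos (ENNReal.toReal_pos hB0 hB), ENNReal.ofReal_toReal hB, mul_comm,
        ← mul_assoc, ENNReal.mul_inv_cancel hB0 hB, one_mul]
    calc ∫⁻ z in cube a l, ‖φ (b z) - φ m‖ₑ ≤ ∫⁻ z in B, ‖b z - m‖ₑ := by
          refine (lintegral_mono_set hsub).trans (lintegral_mono fun z => ?_)
          rw [← ofReal_norm, ← ofReal_norm]
          exact ENNReal.ofReal_le_ofReal (hφ _ _)
      _ ≤ ENNReal.ofReal C * (κ * volume (cube a l)) := by
          rw [h1]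
          gcongr
          exact hC x r hr
      _ ≤ _ := by
          rw [← mul_assoc]
          gcongr
          rw [ENNReal.coe_add, ENNReal.coe_mul]
          exact le_self_add
  choose c hc using key
  exact ⟨c, hc⟩

end MuckenhouptWheeden

/-! ### Multiplication operators, weighted norms and truncations. -/

section Multipliers

variable {n : ℕ}

theorem L0.mul_add (f g h : L0 n) : f * (g + h) = f * g + f * h := by
  refine AEEqFun.induction_on₃ f g h fun f _ g _ h _ => ?_
  simp only [AEEqFun.mk_add_mk, AEEqFun.mk_mul_mk]
  congr 1
  exact _root_.mul_add _ _ _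

theorem L0.mul_smul (c : ℂ) (f g : L0 n) : f * (c • g) = c • (f * g) := by
  refine AEEqFun.induction_on₂ f g fun f _ g _ => ?_
  simp only [AEEqFun.smul_mk, AEEqFun.mk_mul_mk]
  congr 1
  exact mul_smul_comm _ _ _

theorem L0.mul_sub (f g h : L0 n) : f * (g - h) = f * g - f * h := by
  refine AEEqFun.induction_on₃ f g h fun f _ g _ h _ => ?_
  simp only [← AEEqFun.mk_sub, AEEqFun.mk_mul_mk]
  congr 1
  exact _root_.mul_sub _ _ _

/-- The class of a measurable function. -/
noncomputable def ofMeasurable (φ : Rn n → ℂ) (hφ : Measurable φ) : L0 n :=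
  AEEqFun.mk φ hφ.aestronglyMeasurable

theorem coeFn_ofMeasurable {φ : Rn n → ℂ} (hφ : Measurable φ) :
    ofMeasurable φ hφ =ᵐ[volume] φ := AEEqFun.coeFn_mk _ _

theorem coeFn_ofMeasurable_mul {φ : Rn n → ℂ} (hφ : Measurable φ) (f : L0 n) :
    (ofMeasurable φ hφ * f : L0 n) =ᵐ[volume] fun x => φ x * f x := by
  filter_upwards [AEEqFun.coeFn_mul (ofMeasurable φ hφ) f, coeFn_ofMeasurable hφ] with x h1 h2
  rw [h1, Pi.mul_apply, h2]

/-- The class of a weight, as a complex-valued function. -/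
noncomputable def weightL0 {w : Rn n → ℝ≥0} (hw : IsWeight w) : L0 n :=
  ofMeasurable (fun x => ((w x : ℝ) : ℂ))
    (Complex.measurable_ofReal.comp (measurable_coe_nnreal_real.comp hw.1))

theorem coeFn_weightL0_mul {w : Rn n → ℝ≥0} (hw : IsWeight w) (f : L0 n) :
    (weightL0 hw * f : L0 n) =ᵐ[volume] fun x => (w x : ℂ) * f x :=
  coeFn_ofMeasurable_mul _ f

theorem exists_weightL0_mul_eq_one {w : Rn n → ℝ≥0} (hw : IsWeight w) :
    ∃ V : L0 n, weightL0 hw * V = 1 := by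
  have hm : Measurable fun x => ((w x : ℝ) : ℂ)⁻¹ :=
    (Complex.measurable_ofReal.comp (measurable_coe_nnreal_real.comp hw.1)).inv
  refine ⟨ofMeasurable _ hm, AEEqFun.ext ?_⟩
  filter_upwards [coeFn_weightL0_mul hw (ofMeasurable _ hm), coeFn_ofMeasurable hm, hw.2,
    AEEqFun.coeFn_one (α := Rn n) (β := ℂ) (μ := volume)] with x h1 h2 h3 h4
  rw [h1, h2, h4, Pi.one_apply]
  exact mul_inv_cancel₀ (by simpa using h3.ne')

/-- Since `|f| ^ p * w ^ p = |w * f| ^ p`, all weighted estimates can be moved to unweighted `Lp`,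
where the Banach space theory is available. -/
theorem weightedNorm_eq {w : Rn n → ℝ≥0} (hw : IsWeight w) {p : ℝ} (hp : 0 < p) (f : L0 n) :
    weightedNorm p (fun x => w x ^ p) f =
      eLpNorm (weightL0 hw * f : L0 n) (ENNReal.ofReal p) volume := by
  have hp0 : ENNReal.ofReal p ≠ 0 := by simpa using hp
  rw [weightedNorm, eLpNorm_congr_ae (coeFn_weightL0_mul hw f),
    eLpNorm_eq_lintegral_rpow_enorm_toReal hp0 ENNReal.ofReal_ne_top,
    eLpNorm_eq_lintegral_rpow_enorm_toReal hp0 ENNReal.ofReal_ne_top, weightMeasure,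
    ENNReal.toReal_ofReal hp.le, lintegral_withDensity_eq_lintegral_mul₀]
  · congr 1
    refine lintegral_congr fun x => ?_
    rw [Pi.mul_apply, enorm_mul, ENNReal.mul_rpow_of_nonneg _ _ hp.le,
      ENNReal.coe_rpow_of_nonneg _ hp.le]
    congr 2
    simp [← ofReal_norm]
  · exact (hw.1.pow_const p).coe_nnreal_ennreal.aemeasurable
  · exact (AEEqFun.aestronglyMeasurable f).enorm.pow_const p

theorem mem_weightedLp_iff {w : Rn n → ℝ≥0} (hw : IsWeight w) {p : ℝ} (hp : 0 < p) {f : L0 n} :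
    f ∈ WeightedLp p (fun x => w x ^ p) ↔
      weightL0 hw * f ∈ Lp ℂ (ENNReal.ofReal p) (volume : Measure (Rn n)) := by
  rw [Lp.mem_Lp_iff_eLpNorm_lt_top, ← weightedNorm_eq hw hp]
  exact ⟨fun h => h.2, fun h => ⟨(AEEqFun.aestronglyMeasurable f).mono_ac
    (weightMeasure_absolutelyContinuous _), h⟩⟩

/-- Multiplication by a weight identifies the weighted Lebesgue space with the unweighted one. -/
theorem exists_weightedLp_equiv {w : Rn n → ℝ≥0} (hw : IsWeight w) {p : ℝ} (hp : 0 < p) :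
    ∃ e : WeightedLp p (fun x => w x ^ p) ≃ₗ[ℂ] Lp ℂ (ENNReal.ofReal p) (volume : Measure (Rn n)),
      ∀ f, (e f : L0 n) = weightL0 hw * f := by
  obtain ⟨V, hV⟩ := exists_weightL0_mul_eq_one hw
  refine ⟨{ toFun := fun f => ⟨weightL0 hw * f, (mem_weightedLp_iff hw hp).1 f.2⟩
            map_add' := fun f g => Subtype.ext (L0.mul_add _ _ _)
            map_smul' := fun c f => Subtype.ext (L0.mul_smul _ _ _)
            invFun := fun g => ⟨V * g, (mem_weightedLp_iff hw hp).2
              (by rw [← mul_assoc, hV, one_mul]; exact g.2)⟩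
            left_inv := fun f => Subtype.ext ?_
            right_inv := fun g => Subtype.ext ?_ }, fun f => rfl⟩
  · change V * (weightL0 hw * f) = f
    rw [← mul_assoc, mul_comm V, hV, one_mul]
  · change weightL0 hw * (V * g) = g
    rw [← mul_assoc, hV, one_mul]

/-- The class in `L^∞` of a bounded measurable function. -/
noncomputable def ofBounded (φ : Rn n → ℂ) (hφ : Measurable φ) (C : ℝ) (hC : ∀ x, ‖φ x‖ ≤ C) :
    Lp ℂ ∞ (volume : Measure (Rn n)) :=
  (memLp_top_of_bound hφ.aestronglyMeasurable C (Filter.Eventually.of_forall hC)).toLp φ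

theorem norm_ofBounded_le {φ : Rn n → ℂ} (hφ : Measurable φ) {C : ℝ} (hC : ∀ x, ‖φ x‖ ≤ C) :
    ‖ofBounded φ hφ C hC‖ ≤ C := by
  have hC0 : 0 ≤ C := (norm_nonneg _).trans (hC 0)
  rw [ofBounded, Lp.norm_toLp, eLpNorm_exponent_top]
  refine ENNReal.toReal_le_of_le_ofReal hC0 ?_
  exact eLpNormEssSup_le_of_ae_bound (Filter.Eventually.of_forall hC)

/-- Multiplication by bounded functions on `L^p`. -/
noncomputable def mulL (p : ℝ≥0∞) [Fact (1 ≤ p)] :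
    Lp ℂ ∞ (volume : Measure (Rn n)) →L[ℂ]
      Lp ℂ p (volume : Measure (Rn n)) →L[ℂ] Lp ℂ p (volume : Measure (Rn n)) :=
  (ContinuousLinearMap.mul ℂ ℂ).holderL volume ∞ p p

theorem coe_mulL {p : ℝ≥0∞} [Fact (1 ≤ p)] (φ : Lp ℂ ∞ (volume : Measure (Rn n)))
    (f : Lp ℂ p (volume : Measure (Rn n))) : (mulL p φ f : L0 n) = (φ : L0 n) * (f : L0 n) := by
  refine AEEqFun.ext ?_
  filter_upwards [ContinuousLinearMap.coeFn_holder (r := p) (ContinuousLinearMap.mul ℂ ℂ) φ f,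
    AEEqFun.coeFn_mul (φ : L0 n) (f : L0 n)] with x h1 h2
  rw [h2]
  exact h1

theorem norm_mulL_le {p : ℝ≥0∞} [Fact (1 ≤ p)] (φ : Lp ℂ ∞ (volume : Measure (Rn n)))
    (f : Lp ℂ p (volume : Measure (Rn n))) : ‖mulL p φ f‖ ≤ ‖φ‖ * ‖f‖ := by
  refine ((ContinuousLinearMap.mul ℂ ℂ).norm_holder_apply_apply_le φ f).trans ?_
  gcongr
  exact mul_le_of_le_one_left (norm_nonneg _) (ContinuousLinearMap.opNorm_mul_le ℂ ℂ)

theorem MemLinftyC.mul {f : L0 n} (hf : MemLinftyC f) {φ : L0 n}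
    (hφ : MemLp φ ∞ (volume : Measure (Rn n))) : MemLinftyC (φ * f) := by
  obtain ⟨h1, K, hK, h2⟩ := hf
  refine ⟨((h1.mul hφ (r := ∞))).ae_eq (AEEqFun.coeFn_mul φ f).symm, K, hK, ?_⟩
  filter_upwards [h2, AEEqFun.coeFn_mul φ f] with x hx hx' hxK
  rw [hx', Pi.mul_apply, hx hxK, mul_zero]

/-- The indicator of a measurable set, as an element of `L^∞`. -/
noncomputable def indicatorL (A : Set (Rn n)) (hA : MeasurableSet A) :
    Lp ℂ ∞ (volume : Measure (Rn n)) :=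
  ofBounded (A.indicator 1) (measurable_one.indicator hA) 1 fun x =>
    (norm_indicator_le_norm_self _ _).trans (by simp)

theorem coeFn_indicatorL_mul {A : Set (Rn n)} (hA : MeasurableSet A) (f : L0 n) :
    ((indicatorL A hA : L0 n) * f : L0 n) =ᵐ[volume] A.indicator f := by
  filter_upwards [coeFn_ofMeasurable_mul (measurable_one.indicator hA) f] with x hx
  refine hx.trans ?_
  by_cases h : x ∈ A <;> simp [h]

/-- Dominated convergence for the tails, with dominating function `‖f‖ₑ ^ p`. -/
theorem tendsto_mulL_indicatorL {p : ℝ≥0∞} [Fact (1 ≤ p)] (hp : p ≠ ∞)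
    (f : Lp ℂ p (volume : Measure (Rn n))) {A : ℕ → Set (Rn n)} (hA : ∀ k, MeasurableSet (A k))
    (hAe : ∀ᵐ x, ∀ᶠ k in Filter.atTop, x ∈ A k) :
    Filter.Tendsto (fun k => mulL p (indicatorL (A k) (hA k)) f) Filter.atTop (nhds f) := by
  have hp0 : p ≠ 0 := (zero_lt_one.trans_le Fact.out).ne'
  have hpr : 0 < p.toReal := ENNReal.toReal_pos hp0 hp
  rw [Lp.tendsto_Lp_iff_tendsto_eLpNorm']
  have hcoe : ∀ k, (mulL p (indicatorL (A k) (hA k)) f - f : Rn n → ℂ) =ᵐ[volume]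
      (A k)ᶜ.indicator (fun x => -f x) := by
    intro k
    have := coe_mulL (indicatorL (A k) (hA k)) f
    filter_upwards [coeFn_indicatorL_mul (hA k) (f : L0 n)] with x hx
    rw [Pi.sub_apply, this, hx]
    by_cases h : x ∈ A k <;> simp [h]
  have e : ∀ k, eLpNorm (mulL p (indicatorL (A k) (hA k)) f - f : Rn n → ℂ) p volume =
      (∫⁻ x, (A k)ᶜ.indicator (fun x => ‖f x‖ₑ ^ p.toReal) x) ^ (1 / p.toReal) := by
    intro k
    rw [eLpNorm_congr_ae (hcoe k), eLpNorm_eq_lintegral_rpow_enorm_toReal hp0 hp]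
    congr 1
    refine lintegral_congr fun x => ?_
    by_cases h : x ∈ A k <;> simp [h, hpr]
  simp_rw [e]
  have hfin : ∫⁻ x, ‖f x‖ₑ ^ p.toReal ≠ ∞ :=
    (lintegral_rpow_enorm_lt_top_of_eLpNorm_lt_top hp0 hp (Lp.memLp f).2).ne
  have hlim : Filter.Tendsto (fun k => ∫⁻ x, (A k)ᶜ.indicator (fun x => ‖f x‖ₑ ^ p.toReal) x)
      Filter.atTop (nhds (∫⁻ _ : Rn n, 0)) := by
    refine tendsto_lintegral_of_dominated_convergence' (fun x => ‖f x‖ₑ ^ p.toReal) ?_ ?_ hfin ?_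
    · intro k
      exact ((Lp.aestronglyMeasurable f).enorm.pow_const _).indicator (hA k).compl
    · exact fun k => Filter.Eventually.of_forall fun x => Set.indicator_le_self _ _ _
    · filter_upwards [hAe] with x hx
      refine tendsto_const_nhds.congr' ?_
      filter_upwards [hx] with k hk
      simp [hk]
  have := (ENNReal.continuous_rpow_const (y := 1 / p.toReal)).continuousAt.tendsto.comp hlim
  simpa [Function.comp_def, hpr] using this

/-- Cutting off both the domain and the size of `f` gives approximants in `L^∞_c`; this is the
source of all density statements. -/
theorem exists_memLinftyC_tendsto (f : L0 n) : ∃ A : ℕ → Set (Rn n), (∀ k, MeasurableSet (A k)) ∧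
    (∀ k, (A k) ⊆ Metric.closedBall 0 k) ∧ (∀ x, ∀ᶠ k in Filter.atTop, x ∈ A k) ∧
    ∀ k x, x ∈ A k → ‖f x‖ ≤ k := by
  have hfm : Measurable fun x => ‖f x‖ := (AEEqFun.measurable f).norm
  refine ⟨fun k => Metric.closedBall 0 k ∩ {x | ‖f x‖ ≤ k}, fun k =>
    measurableSet_closedBall.inter (measurableSet_le hfm measurable_const),
    fun k => Set.inter_subset_left, fun x => ?_, fun k x hx => hx.2⟩
  obtain ⟨N, hN⟩ := exists_nat_ge (max ‖x‖ ‖f x‖)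
  filter_upwards [Filter.eventually_ge_atTop N] with k hk
  have hk' : (N : ℝ) ≤ k := by exact_mod_cast hk
  refine ⟨?_, ?_⟩
  · simpa using ((le_max_left _ _).trans hN).trans hk'
  · exact ((le_max_right _ _).trans hN).trans hk'

theorem memLinftyC_indicatorL_mul {f : L0 n} {A : Set (Rn n)} (hA : MeasurableSet A) {k : ℕ}
    (hAk : A ⊆ Metric.closedBall 0 k) (hf : ∀ x ∈ A, ‖f x‖ ≤ k) :
    MemLinftyC ((indicatorL A hA : L0 n) * f) := by
  refine ⟨memLp_top_of_bound (AEEqFun.aestronglyMeasurable _) k ?_, _, isCompact_closedBall 0 k, ?_⟩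
  · filter_upwards [coeFn_indicatorL_mul hA f] with x hx
    rw [hx]
    by_cases h : x ∈ A
    · simpa [h] using hf x h
    · simp [h]
  · filter_upwards [coeFn_indicatorL_mul hA f] with x hx hxA
    rw [hx, Set.indicator_of_notMem fun h => hxA (hAk h)]

end Multipliers

/-! ### Extension by continuity from a dense class. -/

section Extension

variable {n : ℕ}

theorem enorm_le_coe_mul_enorm_iff {E F : Type*} [SeminormedAddCommGroup E]
    [SeminormedAddCommGroup F] {x : E} {y : F} {C : ℝ≥0} :
    ‖x‖ₑ ≤ C * ‖y‖ₑ ↔ ‖x‖ ≤ C * ‖y‖ := by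
  rw [enorm_eq_nnnorm, enorm_eq_nnnorm, ← ENNReal.coe_mul, ENNReal.coe_le_coe,
    ← NNReal.coe_le_coe]
  simp

/-- `A` and `B` carry no norm of their own: the extension by continuity is made between `X` and `Y`
and transported back along the linear equivalences. -/
theorem exists_extension_of_denseRange {D A B X Y : Type*} [AddCommMonoid D] [Module ℂ D]
    [AddCommMonoid A] [Module ℂ A] [AddCommMonoid B] [Module ℂ B]
    [NormedAddCommGroup X] [NormedSpace ℂ X] [NormedAddCommGroup Y] [NormedSpace ℂ Y]
    [CompleteSpace Y] (ep : A ≃ₗ[ℂ] X) (eq : B ≃ₗ[ℂ] Y) (g : D →ₗ[ℂ] B) (i : D →ₗ[ℂ] A)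
    (hd : DenseRange fun x => ep (i x)) {C : ℝ} (h : ∀ x, ‖eq (g x)‖ ≤ C * ‖ep (i x)‖) :
    ∃ S : A →ₗ[ℂ] B, (∀ f, ‖eq (S f)‖ ≤ C * ‖ep f‖) ∧ (∀ x, S (i x) = g x) ∧
      (∀ S' : A →ₗ[ℂ] B, (∃ C' : ℝ, ∀ f, ‖eq (S' f)‖ ≤ C' * ‖ep f‖) → (∀ x, S' (i x) = g x) →
        S' = S) ∧ ∃ τ : X →L[ℂ] Y, ∀ f, τ (ep f) = eq (S f) := by
  let _ := Module.addCommMonoidToAddCommGroup ℂ (M := D)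
  let e : D →ₗ[ℂ] X := ep.toLinearMap.comp i
  let g' : D →ₗ[ℂ] Y := eq.toLinearMap.comp g
  have he : DenseRange e := hd
  have hbd : ∀ x, ‖g' x‖ ≤ C * ‖e x‖ := h
  set τ := g'.extendOfNorm e with hτd
  have hτ : ∀ x, τ (e x) = g' x := LinearMap.extendOfNorm_eq he ⟨C, hbd⟩
  refine ⟨eq.symm.toLinearMap.comp (τ.toLinearMap.comp ep.toLinearMap), fun f => ?_, fun x => ?_,
    fun S' hS' hS'i => ?_, τ, fun f => ?_⟩
  · simpa using LinearMap.norm_extendOfNorm_apply_le he C hbd (ep f)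
  · exact eq.symm_apply_eq.2 (hτ x)
  · obtain ⟨C', hC'⟩ := hS'
    let τ' : X →L[ℂ] Y := (eq.toLinearMap.comp (S'.comp ep.symm.toLinearMap)).mkContinuous C'
      fun y => by simpa using hC' (ep.symm y)
    have hττ : τ = τ' := LinearMap.extendOfNorm_unique he C hbd τ' <| LinearMap.ext fun x => by
      simp [τ', e, g', hS'i]
    ext f
    rw [hττ]
    simp [τ']
  · simp

/-- A densely defined operator bounded between weighted Lebesgue spaces has a unique bounded
extension, which is conjugate to a bounded operator between the unweighted spaces. -/
theorem existsUnique_boundedExtension {p q : ℝ} (hp : 1 ≤ p) (hq : 1 ≤ q) [Fact (1 ≤ ENNReal.ofReal p)]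
    [Fact (1 ≤ ENNReal.ofReal q)] {w : Rn n → ℝ≥0} (hw : IsWeight w)
    (hlin : ∀ f : L0 n, MemLinftyC f → f ∈ WeightedLp p (fun x => w x ^ p))
    (G : L0 n →ₗ.[ℂ] L0 n) (hdom : ∀ f : L0 n, MemLinftyC f → f ∈ G.domain) {C : ℝ≥0}
    (hG : ∀ f : G.domain, (f : L0 n) ∈ WeightedLp p (fun x => w x ^ p) →
      weightedNorm q (fun x => w x ^ q) (G f) ≤
        C * weightedNorm p (fun x => w x ^ p) (f : L0 n)) :
    ∃ S : WeightedLp p (fun x => w x ^ p) →ₗ[ℂ] WeightedLp q (fun x => w x ^ q),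
      IsBoundedExtension G S ∧ (∀ S', IsBoundedExtension G S' → S' = S) ∧
      ∃ τ : Lp ℂ (ENNReal.ofReal p) (volume : Measure (Rn n)) →L[ℂ]
        Lp ℂ (ENNReal.ofReal q) (volume : Measure (Rn n)),
        ∀ (f : WeightedLp p (fun x => w x ^ p))
          (g : Lp ℂ (ENNReal.ofReal p) (volume : Measure (Rn n))),
          (g : L0 n) = weightL0 hw * (f : L0 n) → (τ g : L0 n) = weightL0 hw * (S f : L0 n) := by
  have hp0 : 0 < p := by linarith
  have hq0 : 0 < q := by linarith
  obtain ⟨ep, hep⟩ := exists_weightedLp_equiv hw hp0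
  obtain ⟨eq, heq⟩ := exists_weightedLp_equiv hw hq0
  have hnp : ∀ f : WeightedLp p (fun x => w x ^ p),
      weightedNorm p (fun x => w x ^ p) (f : L0 n) = ‖ep f‖ₑ := fun f => by
    rw [weightedNorm_eq hw hp0, Lp.enorm_def, hep]
  have hnq : ∀ f : WeightedLp q (fun x => w x ^ q),
      weightedNorm q (fun x => w x ^ q) (f : L0 n) = ‖eq f‖ₑ := fun f => by
    rw [weightedNorm_eq hw hq0, Lp.enorm_def, heq]
  set D : Submodule ℂ (L0 n) := G.domain ⊓ WeightedLp p (fun x => w x ^ p) with hD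
  have hmem : ∀ x : D, G ⟨x, x.2.1⟩ ∈ WeightedLp q (fun x => w x ^ q) := fun x => by
    refine ⟨(AEEqFun.aestronglyMeasurable _).mono_ac (weightMeasure_absolutelyContinuous _), ?_⟩
    refine (hG ⟨x, x.2.1⟩ x.2.2).trans_lt ?_
    exact ENNReal.mul_lt_top ENNReal.coe_lt_top x.2.2.2
  obtain ⟨g, hg⟩ : ∃ g : D →ₗ[ℂ] WeightedLp q (fun x => w x ^ q),
      ∀ x : D, (g x : L0 n) = G ⟨x, x.2.1⟩ :=
    ⟨(G.toFun.comp (Submodule.inclusion inf_le_left)).codRestrict _ hmem, fun x => rfl⟩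
  obtain ⟨i, hi⟩ : ∃ i : D →ₗ[ℂ] WeightedLp p (fun x => w x ^ p), ∀ x : D, i x = ⟨x, x.2.2⟩ :=
    ⟨Submodule.inclusion inf_le_right, fun x => rfl⟩
  have hdense : DenseRange fun x => ep (i x) := by
    intro y
    obtain ⟨f, rfl⟩ := ep.surjective y
    obtain ⟨A, hAm, hAb, hAe, hAf⟩ := exists_memLinftyC_tendsto (f : L0 n)
    refine mem_closure_of_tendsto (tendsto_mulL_indicatorL ENNReal.ofReal_ne_top (ep f) hAm
      (Filter.Eventually.of_forall hAe)) (Filter.Eventually.of_forall fun k => ?_)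
    have hL := memLinftyC_indicatorL_mul (hAm k) (hAb k) (hAf k)
    refine ⟨⟨_, hdom _ hL, hlin _ hL⟩, Subtype.ext ?_⟩
    rw [hep, coe_mulL, hep, hi]
    exact mul_left_comm _ _ _
  have hbd : ∀ x, ‖eq (g x)‖ ≤ C * ‖ep (i x)‖ := fun x => by
    rw [← enorm_le_coe_mul_enorm_iff, ← hnq, ← hnp, hg, hi]
    exact hG ⟨x, x.2.1⟩ x.2.2
  obtain ⟨S, hSb, hSi, hSu, τ, hτ⟩ := exists_extension_of_denseRange ep eq g i hdense hbd
  refine ⟨S, ⟨⟨C, fun f => ?_⟩, fun f hf => ?_⟩, fun S' hS' => ?_, τ, fun f y hy => ?_⟩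
  · rw [hnp, hnq, enorm_le_coe_mul_enorm_iff]
    exact hSb f
  · have := hSi ⟨f, f.2, hf⟩
    rw [hi] at this
    rw [this, hg]
  · obtain ⟨⟨C', hC'⟩, hS'⟩ := hS'
    refine hSu S' ⟨C', fun f => ?_⟩ fun x => Subtype.ext ?_
    · rw [← enorm_le_coe_mul_enorm_iff, ← hnq, ← hnp]
      exact hC' f
    · rw [hi, hg]
      exact hS' ⟨x, x.2.1⟩ x.2.2
  · have : y = ep f := Subtype.ext (hy.trans (hep f).symm)
    rw [this, ← heq, hτ]

end Extension

/-! ### Holomorphy of `exp (z ψ)` as an `L^∞`-valued function. -/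

section ExponentialConjugation

variable {n : ℕ}

theorem norm_le_of_ae_bound_top {g : Lp ℂ ∞ (volume : Measure (Rn n))} {C : ℝ} (hC : 0 ≤ C)
    (h : ∀ᵐ x, ‖g x‖ ≤ C) : ‖g‖ ≤ C := by
  rw [Lp.norm_def, eLpNorm_exponent_top]
  exact ENNReal.toReal_le_of_le_ofReal hC (eLpNormEssSup_le_of_ae_bound h)

variable {ψ : Rn n → ℝ} (hψ : Measurable ψ) {k : ℝ} (hk : ∀ x, |ψ x| ≤ k)

theorem norm_cexp_mul_le {t k : ℝ} (ht : |t| ≤ k) (z : ℂ) :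
    ‖Complex.exp (z * t)‖ ≤ Real.exp (|z.re| * k) := by
  rw [Complex.norm_exp]
  apply Real.exp_le_exp.2
  simp only [Complex.mul_re, Complex.ofReal_re, Complex.ofReal_im, mul_zero, sub_zero]
  exact (le_abs_self _).trans (by rw [abs_mul]; gcongr)

/-- The bounded function `exp (z ψ)`, as an element of `L^∞`. -/
noncomputable def expL (z : ℂ) : Lp ℂ ∞ (volume : Measure (Rn n)) :=
  ofBounded (fun x => Complex.exp (z * ψ x)) (by fun_prop) (Real.exp (|z.re| * k))
    fun x => norm_cexp_mul_le (hk x) z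

theorem norm_expL_le (z : ℂ) : ‖expL hψ hk z‖ ≤ Real.exp (|z.re| * k) := norm_ofBounded_le _ _

theorem coeFn_expL (z : ℂ) : expL hψ hk z =ᵐ[volume] fun x => Complex.exp (z * ψ x) :=
  coeFn_ofMeasurable (by fun_prop)

theorem coeFn_expL_mul (z : ℂ) (f : L0 n) :
    ((expL hψ hk z : L0 n) * f : L0 n) =ᵐ[volume] fun x => Complex.exp (z * ψ x) * f x :=
  coeFn_ofMeasurable_mul (by fun_prop) _

/-- A bounded real function, as an element of `L^∞`. -/
noncomputable def realL : Lp ℂ ∞ (volume : Measure (Rn n)) :=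
  ofBounded (fun x => (ψ x : ℂ)) (by fun_prop) k fun x => by simpa using hk x

theorem coeFn_realL : realL hψ hk =ᵐ[volume] fun x => (ψ x : ℂ) :=
  coeFn_ofMeasurable (by fun_prop)

theorem coeFn_realL_mul (f : L0 n) :
    ((realL hψ hk : L0 n) * f : L0 n) =ᵐ[volume] fun x => (ψ x : ℂ) * f x :=
  coeFn_ofMeasurable_mul (by fun_prop) _

/-- The derivative of `expL`. -/
noncomputable def derivExpL (z : ℂ) : Lp ℂ ∞ (volume : Measure (Rn n)) :=
  ofBounded (fun x => ψ x * Complex.exp (z * ψ x)) (by fun_prop) (k * Real.exp (|z.re| * k))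
    fun x => by
      rw [norm_mul]
      gcongr
      · exact (abs_nonneg _).trans (hk x)
      · simpa using hk x
      · exact norm_cexp_mul_le (hk x) z

theorem coeFn_derivExpL (z : ℂ) :
    derivExpL hψ hk z =ᵐ[volume] fun x => ψ x * Complex.exp (z * ψ x) :=
  coeFn_ofMeasurable (by fun_prop)

/-- Because `ψ` is bounded, the second-order Taylor remainder of the exponential is uniform in `x`,
so the derivative exists in the `L^∞` norm. -/
theorem hasDerivAt_expL (z : ℂ) : HasDerivAt (expL hψ hk) (derivExpL hψ hk z) z := by
  have hk0 : 0 ≤ k := (abs_nonneg _).trans (hk 0)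
  rw [hasDerivAt_iff_isLittleO_nhds_zero]
  refine Asymptotics.IsBigO.trans_isLittleO ?_ (Asymptotics.isLittleO_pow_id one_lt_two)
  refine Asymptotics.IsBigO.of_bound (Real.exp (|z.re| * k) * k ^ 2) ?_
  filter_upwards [Metric.ball_mem_nhds (0 : ℂ) (ε := 1 / (k + 1)) (by positivity)] with h hh
  have hh' : ‖h‖ * k ≤ 1 := by
    have h1 : ‖h‖ < 1 / (k + 1) := by simpa using hh
    rw [lt_div_iff₀ (by positivity)] at h1
    nlinarith [norm_nonneg h]
  refine norm_le_of_ae_bound_top (by positivity) ?_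
  filter_upwards [Lp.coeFn_sub (expL hψ hk (z + h) - expL hψ hk z) (h • derivExpL hψ hk z),
    Lp.coeFn_sub (expL hψ hk (z + h)) (expL hψ hk z), Lp.coeFn_smul h (derivExpL hψ hk z),
    coeFn_expL hψ hk (z + h), coeFn_expL hψ hk z, coeFn_derivExpL hψ hk z]
    with x h1 h2 h3 h4 h5 h6
  rw [h1, Pi.sub_apply, h2, Pi.sub_apply, h3, Pi.smul_apply, h4, h5, h6]
  have e : Complex.exp ((z + h) * ψ x) - Complex.exp (z * ψ x) -
      h • ((ψ x : ℂ) * Complex.exp (z * ψ x)) =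
      Complex.exp (z * ψ x) * (Complex.exp (h * ψ x) - 1 - h * ψ x) := by
    rw [add_mul, Complex.exp_add, smul_eq_mul]; ring
  have hn : ‖h * (ψ x : ℂ)‖ ≤ ‖h‖ * k := by
    rw [norm_mul]; gcongr; simpa using hk x
  rw [e, norm_mul, norm_pow, mul_assoc]
  gcongr
  · exact norm_cexp_mul_le (hk x) z
  · refine (Complex.norm_exp_sub_one_sub_id_le (hn.trans hh')).trans ?_
    calc ‖h * (ψ x : ℂ)‖ ^ 2 ≤ (‖h‖ * k) ^ 2 := by gcongr
      _ = _ := by ring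

end ExponentialConjugation

/-! ### Commutators with truncated functions, by complex interpolation on a strip. -/

section Commutator

variable {n : ℕ} {p q : ℝ≥0∞} [Fact (1 ≤ p)] [Fact (1 ≤ q)]

theorem norm_le_of_eLpNorm_le {x : Lp ℂ p (volume : Measure (Rn n))}
    {y : Lp ℂ q (volume : Measure (Rn n))} {C : ℝ≥0}
    (h : eLpNorm y q volume ≤ C * eLpNorm x p volume) : ‖y‖ ≤ C * ‖x‖ := by
  rw [← enorm_le_coe_mul_enorm_iff, Lp.enorm_def, Lp.enorm_def]
  exact h

/-- The class of `exp (σ r)`. -/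
noncomputable def expL0 {r : Rn n → ℝ} (hr : Measurable r) (σ : ℝ) : L0 n :=
  ofMeasurable (fun x => ((Real.exp (σ * r x) : ℝ) : ℂ)) (by fun_prop)

theorem coeFn_expL0_mul {r : Rn n → ℝ} (hr : Measurable r) (σ : ℝ) (f : L0 n) :
    (expL0 hr σ * f : L0 n) =ᵐ[volume] fun x => ((Real.exp (σ * r x) : ℝ) : ℂ) * f x :=
  coeFn_ofMeasurable_mul (by fun_prop) _

theorem measurableSet_abs_le {r : Rn n → ℝ} (hr : Measurable r) (k : ℕ) :
    MeasurableSet {x | |r x| ≤ k} := measurableSet_le (by fun_prop) measurable_const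

theorem abs_indicator_le (r : Rn n → ℝ) (k : ℕ) (x : Rn n) :
    |{x | |r x| ≤ k}.indicator r x| ≤ k := by
  by_cases h : |r x| ≤ k
  · rw [Set.indicator_of_mem (by exact h)]; exact h
  · rw [Set.indicator_of_notMem (by exact h)]; simp

/-- The circle `|z| = ε` lies in the strip, where Phragmén–Lindelöf gives the bound `M` from the two
edges; Cauchy's estimate finishes. The bound `B` only excludes growth and does not enter the result.
-/
theorem norm_deriv_zero_le_of_strip {Y : Type*} [NormedAddCommGroup Y] [NormedSpace ℂ Y] {F : ℂ → Y}
    (hF : Differentiable ℂ F) {ε B M : ℝ} (hε : 0 < ε) (hB : ∀ z : ℂ, |z.re| ≤ ε → ‖F z‖ ≤ B)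
    (hM : ∀ z : ℂ, |z.re| = ε → ‖F z‖ ≤ M) : ‖deriv F 0‖ ≤ M / ε := by
  refine Complex.norm_deriv_le_of_forall_mem_sphere_norm_le hε hF.diffContOnCl fun z hz => ?_
  have hz' : |z.re| ≤ ε :=
    (Complex.abs_re_le_norm z).trans (by simpa using (mem_sphere_zero_iff_norm.1 hz).le)
  rw [abs_le] at hz'
  refine PhragmenLindelof.vertical_strip (a := -ε) (b := ε) hF.diffContOnCl
    ⟨0, div_pos Real.pi_pos (by linarith), 0, Asymptotics.IsBigO.of_bound B ?_⟩
    (fun z hz => hM z (by rw [hz, abs_neg, abs_of_pos hε]))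
    (fun z hz => hM z (by rw [hz, abs_of_pos hε])) hz'.1 hz'.2
  refine Filter.Eventually.filter_mono inf_le_right ?_
  filter_upwards [Filter.mem_principal_self _] with y hy
  simpa using hB y (abs_le.2 ⟨hy.1.le, hy.2.le⟩)

theorem hasDerivAt_conjugation {E X Y : Type*} [NormedAddCommGroup E] [NormedSpace ℂ E]
    [NormedAddCommGroup X] [NormedSpace ℂ X] [NormedAddCommGroup Y] [NormedSpace ℂ Y]
    (P : E →L[ℂ] X →L[ℂ] X) (Q : E →L[ℂ] Y →L[ℂ] Y) (τ : X →L[ℂ] Y) {e e' : ℂ → E}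
    (he : ∀ z, HasDerivAt e (e' z) z) (a : E) (x : X) (z : ℂ) :
    HasDerivAt (fun z => Q a (Q (e z) (τ (P (e (-z)) x))))
      (Q a (Q (e' z) (τ (P (e (-z)) x)) - Q (e z) (τ (P (e' (-z)) x)))) z := by
  have h1 : HasDerivAt (fun z => e (-z)) ((-1 : ℂ) • e' (-z)) z := (he (-z)).scomp z (hasDerivAt_neg z)
  have h2 := (τ.comp (P.flip x)).hasFDerivAt.comp_hasDerivAt z h1
  have h3 := Q.hasFDerivAt.comp_hasDerivAt z (he z)
  have h4 := (Q a).hasFDerivAt.comp_hasDerivAt z (h3.clm_apply h2)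
  refine h4.congr_deriv ?_
  simp [sub_eq_add_neg]

/-- The strip estimate applied to `e z ∘ τ ∘ e (-z)`, whose derivative at `0` is the commutator of
`τ` with `e' 0`. The multiplier `a` cuts off the output. -/
theorem norm_commutator_le_of_conjugation {E X Y : Type*} [NormedAddCommGroup E] [NormedSpace ℂ E]
    [NormedAddCommGroup X] [NormedSpace ℂ X] [NormedAddCommGroup Y] [NormedSpace ℂ Y]
    (P : E →L[ℂ] X →L[ℂ] X) (Q : E →L[ℂ] Y →L[ℂ] Y) (τ : X →L[ℂ] Y) {e e' : ℂ → E}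
    (he : ∀ z, HasDerivAt e (e' z) z) (a : E) (x : X) {ε B M : ℝ} (hε : 0 < ε)
    (hB : ∀ z : ℂ, |z.re| ≤ ε → ‖e z‖ ≤ B)
    (hM : ∀ z : ℂ, |z.re| = ε → ‖Q a (Q (e z) (τ (P (e (-z)) x)))‖ ≤ M)
    (hP : ∀ x, P (e 0) x = x) (hQ : ∀ y, Q (e 0) y = y) :
    ‖Q a (Q (e' 0) (τ x) - τ (P (e' 0) x))‖ ≤ M / ε := by
  have hder := hasDerivAt_conjugation P Q τ he a x
  have hB0 : 0 ≤ B := (norm_nonneg _).trans (hB 0 (by simpa using hε.le))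
  have h := norm_deriv_zero_le_of_strip (B := ‖Q a‖ * (‖Q‖ * B * (‖τ‖ * (‖P‖ * B * ‖x‖))))
    (fun z => (hder z).differentiableAt) hε (fun z hz => ?_) hM
  · rw [(hder 0).deriv] at h
    simpa only [neg_zero, hP, hQ] using h
  · have hz' : |(-z).re| ≤ ε := by simpa using hz
    refine (ContinuousLinearMap.le_opNorm _ _).trans ?_
    gcongr
    refine (ContinuousLinearMap.le_opNorm₂ _ _ _).trans ?_
    gcongr
    · exact hB z hz
    refine (ContinuousLinearMap.le_opNorm _ _).trans ?_
    gcongr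
    refine (ContinuousLinearMap.le_opNorm₂ _ _ _).trans ?_
    gcongr
    exact hB _ hz'

section Pointwise

variable {r : Rn n → ℝ} (hr : Measurable r) (k : ℕ)

/-- The indicator of the set where `|r| ≤ k`. -/
noncomputable def levelL : Lp ℂ ∞ (volume : Measure (Rn n)) :=
  indicatorL _ (measurableSet_abs_le hr k)

/-- The function `exp (z r)`, with `r` truncated to the set where `|r| ≤ k`. -/
noncomputable def truncExpL (z : ℂ) : Lp ℂ ∞ (volume : Measure (Rn n)) :=
  expL (hr.indicator (measurableSet_abs_le hr k)) (abs_indicator_le r k) z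

/-- The function `r`, truncated to the set where `|r| ≤ k`. -/
noncomputable def truncL : Lp ℂ ∞ (volume : Measure (Rn n)) :=
  realL (hr.indicator (measurableSet_abs_le hr k)) (abs_indicator_le r k)

/-- The cutoff is essential: off the level set the truncated exponential equals `1`, while `exp (Re
z * r)` may be arbitrarily small. -/
theorem eLpNorm_levelL_mul_truncExpL_mul_le (z : ℂ) (g : L0 n) (s : ℝ≥0∞) :
    eLpNorm ((levelL hr k : L0 n) * ((truncExpL hr k z : L0 n) * g) : L0 n) s volume ≤
      eLpNorm (expL0 hr z.re * g : L0 n) s volume := by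
  refine eLpNorm_mono_ae ?_
  filter_upwards [coeFn_expL0_mul hr z.re g,
    coeFn_indicatorL_mul (measurableSet_abs_le hr k) ((truncExpL hr k z : L0 n) * g),
    coeFn_expL_mul (hr.indicator (measurableSet_abs_le hr k)) (abs_indicator_le r k) z g]
    with y h1 h2 h3
  rw [h1]
  refine (congrArg norm h2).trans_le ?_
  by_cases hy : y ∈ {x | |r x| ≤ k}
  · rw [Set.indicator_of_mem hy]
    refine (congrArg norm h3).trans_le ?_
    rw [norm_mul, norm_mul, Complex.norm_exp, Set.indicator_of_mem hy, Complex.norm_real,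
      Real.norm_eq_abs, Real.abs_exp, Complex.re_mul_ofReal]
  · rw [Set.indicator_of_notMem hy, norm_zero]
    positivity

/-- On the level set, which carries `g`, the two exponentials cancel up to a unimodular factor. -/
theorem eLpNorm_expL0_mul_truncExpL_mul_le (z : ℂ) {g : L0 n} (hg : (levelL hr k : L0 n) * g = g)
    (s : ℝ≥0∞) :
    eLpNorm (expL0 hr z.re * ((truncExpL hr k (-z) : L0 n) * g) : L0 n) s volume ≤
      eLpNorm g s volume := by
  refine eLpNorm_mono_ae ?_
  filter_upwards [coeFn_expL0_mul hr z.re ((truncExpL hr k (-z) : L0 n) * g),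
    coeFn_indicatorL_mul (measurableSet_abs_le hr k) g,
    coeFn_expL_mul (hr.indicator (measurableSet_abs_le hr k)) (abs_indicator_le r k) (-z) g]
    with y h1 h2 h3
  replace h2 := (congrArg (fun f : L0 n => f y) hg).symm.trans h2
  rw [h1]
  by_cases hy : y ∈ {x | |r x| ≤ k}
  · have h3' : ((truncExpL hr k (-z) : L0 n) * g : L0 n) y = _ := h3
    rw [h3', norm_mul, norm_mul, Complex.norm_exp, Set.indicator_of_mem hy, Complex.norm_real,
      Real.norm_eq_abs, Real.abs_exp, Complex.re_mul_ofReal, ← mul_assoc, ← Real.exp_add]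
    simp
  · rw [Set.indicator_of_notMem hy] at h2
    have h3' : ((truncExpL hr k (-z) : L0 n) * g : L0 n) y = _ := h3
    rw [h3', h2]
    simp

theorem mulL_truncExpL_zero (y : Lp ℂ p (volume : Measure (Rn n))) :
    mulL p (truncExpL hr k 0) y = y := by
  refine Subtype.ext ((coe_mulL _ _).trans (AEEqFun.ext ?_))
  filter_upwards [coeFn_expL_mul (hr.indicator (measurableSet_abs_le hr k)) (abs_indicator_le r k)
    0 (y : L0 n)] with z hz
  refine hz.trans ?_
  simp

theorem hasDerivAt_truncExpL (z : ℂ) :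
    HasDerivAt (truncExpL hr k) (derivExpL (hr.indicator (measurableSet_abs_le hr k))
      (abs_indicator_le r k) z) z :=
  hasDerivAt_expL _ _ z

theorem norm_truncExpL_le (z : ℂ) : ‖truncExpL hr k z‖ ≤ Real.exp (|z.re| * k) :=
  norm_expL_le _ _ z

end Pointwise

/-- If conjugating by `exp (± ε r)` leaves an operator bounded on a multiplier-stable class, then
its commutator with the truncations of `r` is bounded on that class. -/
theorem norm_truncated_commutator_le
    (τ : Lp ℂ p (volume : Measure (Rn n)) →L[ℂ] Lp ℂ q (volume : Measure (Rn n)))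
    {𝒟 : Set (Lp ℂ p (volume : Measure (Rn n)))} (h𝒟 : ∀ φ, ∀ x ∈ 𝒟, mulL p φ x ∈ 𝒟)
    {r : Rn n → ℝ} (hr : Measurable r) {ε : ℝ} (hε : 0 < ε) {C : ℝ≥0}
    (hC : ∀ σ : ℝ, |σ| = ε → ∀ x ∈ 𝒟,
      eLpNorm (expL0 hr σ * (τ x : L0 n) : L0 n) q volume ≤
        C * eLpNorm (expL0 hr σ * (x : L0 n) : L0 n) p volume)
    (k : ℕ) {x : Lp ℂ p (volume : Measure (Rn n))} (hx : x ∈ 𝒟)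
    (hxA : mulL p (levelL hr k) x = x) :
    ‖mulL q (levelL hr k)
      (mulL q (truncL hr k) (τ x) -
        τ (mulL p (truncL hr k) x))‖ ≤
      C * ‖x‖ / ε := by
  have hxA' : (levelL hr k : L0 n) * (x : L0 n) = x :=
    (coe_mulL _ _).symm.trans (congrArg Subtype.val hxA)
  have hd0 : derivExpL (hr.indicator (measurableSet_abs_le hr k)) (abs_indicator_le r k) 0 =
      truncL hr k := by
    refine Subtype.ext (AEEqFun.ext ?_)
    filter_upwards [coeFn_derivExpL (hr.indicator (measurableSet_abs_le hr k))
      (abs_indicator_le r k) 0, coeFn_realL (hr.indicator (measurableSet_abs_le hr k))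
      (abs_indicator_le r k)] with y h1 h2
    refine h1.trans (Eq.trans ?_ h2.symm)
    simp
  rw [← hd0]
  refine norm_commutator_le_of_conjugation (mulL p) (mulL q) τ (hasDerivAt_truncExpL hr k)
    (levelL hr k) x (B := Real.exp (ε * k)) hε
    (fun z hz => (norm_truncExpL_le hr k z).trans (by gcongr)) (fun z hz => ?_)
    (mulL_truncExpL_zero hr k) (mulL_truncExpL_zero hr k)
  refine norm_le_of_eLpNorm_le ?_
  -- Stability of `𝒟` under multipliers lets the weighted bound be applied to `exp (-z r) x`. Only
  -- `Re z = ± ε` matters.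
  have h1 := hC z.re hz _ (h𝒟 (truncExpL hr k (-z)) x hx)
  have h2 := eLpNorm_levelL_mul_truncExpL_mul_le hr k z
    (τ (mulL p (truncExpL hr k (-z)) x) : L0 n) q
  have h3 := eLpNorm_expL0_mul_truncExpL_mul_le hr k z hxA' p
  refine (congrArg (fun f : L0 n => eLpNorm f q volume) ((coe_mulL _ _).trans
    (congrArg _ (coe_mulL _ _)))).trans_le (h2.trans (h1.trans ?_))
  refine mul_le_mul_right (le_trans (le_of_eq ?_) h3) _
  exact congrArg (fun f : L0 n => eLpNorm (expL0 hr z.re * f : L0 n) p volume) (coe_mulL _ _)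

end Commutator

/-! ### Removal of the truncation. -/

section UntruncatedCommutator

variable {n : ℕ} {p q : ℝ≥0∞} [Fact (1 ≤ p)] [Fact (1 ≤ q)]

/-- The class of a real measurable function. -/
noncomputable def realL0 {r : Rn n → ℝ} (hr : Measurable r) : L0 n :=
  ofMeasurable (fun x => (r x : ℂ)) (by fun_prop)

theorem coeFn_realL0_mul {r : Rn n → ℝ} (hr : Measurable r) (f : L0 n) :
    (realL0 hr * f : L0 n) =ᵐ[volume] fun x => (r x : ℂ) * f x :=
  coeFn_ofMeasurable_mul (by fun_prop) _

theorem coeFn_levelL_mul {r : Rn n → ℝ} (hr : Measurable r) (k : ℕ) (f : L0 n) :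
    ((levelL hr k : L0 n) * f : L0 n) =ᵐ[volume] {x | |r x| ≤ k}.indicator f :=
  coeFn_indicatorL_mul (measurableSet_abs_le hr k) f

theorem coeFn_truncL_mul {r : Rn n → ℝ} (hr : Measurable r) (k : ℕ) (f : L0 n) :
    ((truncL hr k : L0 n) * f : L0 n) =ᵐ[volume]
      fun x => (({x | |r x| ≤ k}.indicator r x : ℝ) : ℂ) * f x :=
  coeFn_realL_mul (hr.indicator (measurableSet_abs_le hr k)) (abs_indicator_le r k) f

theorem coeFn_mulL_levelL_sub {r : Rn n → ℝ} (hr : Measurable r) (k : ℕ)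
    (u v : Lp ℂ q (volume : Measure (Rn n))) :
    mulL q (levelL hr k) (mulL q (truncL hr k) u - v) =ᵐ[volume]
      {x | |r x| ≤ k}.indicator fun x => (r x : ℂ) * u x - v x := by
  have e1 : (mulL q (levelL hr k) (mulL q (truncL hr k) u - v) : L0 n) =
      (levelL hr k : L0 n) * ((truncL hr k : L0 n) * (u : L0 n) - (v : L0 n)) :=
    (coe_mulL _ _).trans (congrArg (fun f : L0 n => (levelL hr k : L0 n) * (f - (v : L0 n)))
      (coe_mulL _ _))
  rw [e1]
  filter_upwards [coeFn_levelL_mul hr k ((truncL hr k : L0 n) * (u : L0 n) - (v : L0 n)),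
    coeFn_truncL_mul hr k (u : L0 n), AEEqFun.coeFn_sub ((truncL hr k : L0 n) * (u : L0 n))
      (v : L0 n)] with x h1 h2 h3
  rw [h1]
  by_cases hx : x ∈ {x | |r x| ≤ k}
  · rw [Set.indicator_of_mem hx, Set.indicator_of_mem hx, h3, Pi.sub_apply, h2,
      Set.indicator_of_mem hx]
  · rw [Set.indicator_of_notMem hx, Set.indicator_of_notMem hx]

theorem mulL_truncL_mulL_indicatorL {r : Rn n → ℝ} (hr : Measurable r) (k : ℕ) {B : Set (Rn n)}
    (hB : MeasurableSet B) {x y : Lp ℂ p (volume : Measure (Rn n))}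
    (hy : (y : L0 n) = realL0 hr * (x : L0 n)) :
    mulL p (truncL hr k) (mulL p (indicatorL _ ((measurableSet_abs_le hr k).inter hB)) x) =
      mulL p (indicatorL _ ((measurableSet_abs_le hr k).inter hB)) y := by
  refine Subtype.ext (((coe_mulL _ _).trans (congrArg _ (coe_mulL _ _))).trans
    (Eq.trans (AEEqFun.ext ?_) (coe_mulL _ _).symm))
  rw [hy]
  filter_upwards [coeFn_truncL_mul hr k
    ((indicatorL _ ((measurableSet_abs_le hr k).inter hB) : L0 n) * (x : L0 n)),
    coeFn_indicatorL_mul ((measurableSet_abs_le hr k).inter hB) (x : L0 n),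
    coeFn_indicatorL_mul ((measurableSet_abs_le hr k).inter hB) (realL0 hr * (x : L0 n)),
    coeFn_realL0_mul hr (x : L0 n)] with z h1 h2 h3 h4
  rw [h1, h2, h3]
  by_cases hz : z ∈ {x | |r x| ≤ k} ∩ B
  · rw [Set.indicator_of_mem hz, Set.indicator_of_mem hz, Set.indicator_of_mem hz.1, h4]
  · rw [Set.indicator_of_notMem hz, Set.indicator_of_notMem hz, mul_zero]

theorem mulL_levelL_mulL_indicatorL {r : Rn n → ℝ} (hr : Measurable r) (k : ℕ) {B : Set (Rn n)}
    (hB : MeasurableSet B) (x : Lp ℂ p (volume : Measure (Rn n))) :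
    mulL p (levelL hr k) (mulL p (indicatorL _ ((measurableSet_abs_le hr k).inter hB)) x) =
      mulL p (indicatorL _ ((measurableSet_abs_le hr k).inter hB)) x := by
  refine Subtype.ext (((coe_mulL _ _).trans (congrArg _ (coe_mulL _ _))).trans
    (Eq.trans (AEEqFun.ext ?_) (coe_mulL _ _).symm))
  filter_upwards [coeFn_levelL_mul hr k
    ((indicatorL _ ((measurableSet_abs_le hr k).inter hB) : L0 n) * (x : L0 n)),
    coeFn_indicatorL_mul ((measurableSet_abs_le hr k).inter hB) (x : L0 n)] with z h1 h2
  rw [h1]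
  by_cases hz : z ∈ {x | |r x| ≤ k}
  · rw [Set.indicator_of_mem hz]
  · rw [Set.indicator_of_notMem hz, h2, Set.indicator_of_notMem fun h => hz h.1]

theorem mulL_indicatorL_inter {A B : Set (Rn n)} (hA : MeasurableSet A) (hB : MeasurableSet B)
    (x : Lp ℂ p (volume : Measure (Rn n))) :
    mulL p (indicatorL _ (hA.inter hB)) x = mulL p (indicatorL _ hA) (mulL p (indicatorL _ hB) x) := by
  refine Subtype.ext ((coe_mulL _ _).trans (Eq.trans (AEEqFun.ext ?_)
    ((coe_mulL _ _).trans (congrArg _ (coe_mulL _ _))).symm))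
  filter_upwards [coeFn_indicatorL_mul (hA.inter hB) (x : L0 n),
    coeFn_indicatorL_mul hB (x : L0 n),
    coeFn_indicatorL_mul hA ((indicatorL _ hB : L0 n) * (x : L0 n))] with z h1 h2 h3
  rw [h1, h3, ← Set.indicator_indicator]
  by_cases hz : z ∈ A
  · rw [Set.indicator_of_mem hz, Set.indicator_of_mem hz, h2]
  · rw [Set.indicator_of_notMem hz, Set.indicator_of_notMem hz]

theorem norm_mulL_indicatorL_le {A : Set (Rn n)} (hA : MeasurableSet A)
    (x : Lp ℂ p (volume : Measure (Rn n))) : ‖mulL p (indicatorL A hA) x‖ ≤ ‖x‖ :=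
  (norm_mulL_le _ _).trans
    (mul_le_of_le_one_left (norm_nonneg _) (norm_ofBounded_le _ _))

theorem eLpNorm_le_of_tendsto_of_norm_le {G : ℕ → Lp ℂ q (volume : Measure (Rn n))} {u : L0 n}
    {M : ℝ} (hG : ∀ m, ‖G m‖ ≤ M)
    (hu : ∀ᵐ z, Filter.Tendsto (fun m => G m z) Filter.atTop (nhds (u z))) :
    eLpNorm u q volume ≤ ENNReal.ofReal M := by
  refine Lp.eLpNorm_le_of_ae_tendsto (Filter.Eventually.of_forall fun m => ?_)
    (fun m => Lp.aestronglyMeasurable (G m)) hu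
  rw [← Lp.enorm_def, ← ofReal_norm]
  exact ENNReal.ofReal_le_ofReal (hG m)

/-- If conjugating by `exp (± ε r)` leaves an operator bounded on a multiplier-stable dense class,
then its commutator with `r` is bounded. -/
theorem eLpNorm_commutator_le (hp : p ≠ ∞)
    (τ : Lp ℂ p (volume : Measure (Rn n)) →L[ℂ] Lp ℂ q (volume : Measure (Rn n)))
    {𝒟 : Set (Lp ℂ p (volume : Measure (Rn n)))} (h𝒟 : ∀ φ, ∀ x ∈ 𝒟, mulL p φ x ∈ 𝒟)
    {r : Rn n → ℝ} (hr : Measurable r) {ε : ℝ} (hε : 0 < ε) {C : ℝ≥0}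
    (hC : ∀ σ : ℝ, |σ| = ε → ∀ x ∈ 𝒟,
      eLpNorm (expL0 hr σ * (τ x : L0 n) : L0 n) q volume ≤
        C * eLpNorm (expL0 hr σ * (x : L0 n) : L0 n) p volume)
    {x y : Lp ℂ p (volume : Measure (Rn n))} (hy : (y : L0 n) = realL0 hr * (x : L0 n))
    {B : ℕ → Set (Rn n)} (hB : ∀ k, MeasurableSet (B k)) (hBe : ∀ z, ∀ᶠ k in Filter.atTop, z ∈ B k)
    (hBx : ∀ k, mulL p (indicatorL (B k) (hB k)) x ∈ 𝒟) :
    eLpNorm (realL0 hr * (τ x : L0 n) - (τ y : L0 n) : L0 n) q volume ≤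
      ENNReal.ofReal (C * ‖x‖ / ε) := by
  have hm : ∀ k : ℕ, MeasurableSet ({x | |r x| ≤ k} ∩ B k) := fun k =>
    (measurableSet_abs_le hr k).inter (hB k)
  have hme : ∀ᵐ z : Rn n, ∀ᶠ k : ℕ in Filter.atTop, z ∈ {x | |r x| ≤ k} ∩ B k := by
    refine Filter.Eventually.of_forall fun z => ?_
    filter_upwards [hBe z, tendsto_natCast_atTop_atTop.eventually_ge_atTop |r z|] with k h1 h2
    exact ⟨h2, h1⟩
  have hx := tendsto_mulL_indicatorL hp x hm hme
  have hyl := tendsto_mulL_indicatorL hp y hm hme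
  -- On the support of the cut-off `x` the truncation of `r` is `r` itself, so the truncated product
  -- is the same cut-off of `y`.
  have hbound : ∀ k, ‖mulL q (levelL hr k) (mulL q (truncL hr k)
      (τ (mulL p (indicatorL _ (hm k)) x)) - τ (mulL p (indicatorL _ (hm k)) y))‖ ≤
      C * ‖x‖ / ε := by
    intro k
    have hmem : mulL p (indicatorL _ (hm k)) x ∈ 𝒟 := by
      rw [mulL_indicatorL_inter (measurableSet_abs_le hr k) (hB k)]
      exact h𝒟 _ _ (hBx k)
    have h1 := norm_truncated_commutator_le τ h𝒟 hr hε hC k hmem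
      (mulL_levelL_mulL_indicatorL hr k (hB k) x)
    rw [mulL_truncL_mulL_indicatorL hr k (hB k) hy] at h1
    refine h1.trans ?_
    have := norm_mulL_indicatorL_le (hm k) x
    gcongr
  -- The output level `m` is kept fixed while the input cut-off `k` tends to infinity; for `k ≥ m`
  -- the level set of `m` lies in that of `k`, and both truncations agree there.
  have hlevel : ∀ m, ‖mulL q (levelL hr m) (mulL q (truncL hr m) (τ x) - τ y)‖ ≤
      C * ‖x‖ / ε := by
    intro m
    have hcont : Continuous fun a : Lp ℂ p (volume : Measure (Rn n)) ×
        Lp ℂ p (volume : Measure (Rn n)) =>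
        mulL q (levelL hr m) (mulL q (truncL hr m) (τ a.1) - τ a.2) := by fun_prop
    have hlim := (hcont.tendsto (x, y)).comp (hx.prodMk_nhds hyl)
    refine le_of_tendsto hlim.norm ?_
    filter_upwards [Filter.eventually_ge_atTop m] with k hk
    refine le_trans ?_ (hbound k)
    refine Lp.norm_le_norm_of_ae_le ?_
    filter_upwards [coeFn_mulL_levelL_sub hr m (τ (mulL p (indicatorL _ (hm k)) x))
      (τ (mulL p (indicatorL _ (hm k)) y)), coeFn_mulL_levelL_sub hr k
      (τ (mulL p (indicatorL _ (hm k)) x)) (τ (mulL p (indicatorL _ (hm k)) y))] with z h1 h2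
    refine (congrArg norm h1).trans_le (le_trans ?_ (congrArg norm h2).symm.le)
    refine norm_indicator_le_of_subset (fun z hz => ?_) _ _
    exact le_trans (show |r z| ≤ m from hz) (by exact_mod_cast hk)
  -- Fatou's lemma as `m` tends to infinity; at almost every point the sequence is eventually
  -- constant.
  refine eLpNorm_le_of_tendsto_of_norm_le hlevel ?_
  filter_upwards [ae_all_iff.2 fun m => coeFn_mulL_levelL_sub hr m (τ x) (τ y),
    AEEqFun.coeFn_sub (realL0 hr * (τ x : L0 n)) (τ y : L0 n),
    coeFn_realL0_mul hr (τ x : L0 n)] with z h1 h2 h3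
  refine tendsto_const_nhds.congr' ?_
  filter_upwards [tendsto_natCast_atTop_atTop.eventually_ge_atTop |r z|] with m hz
  rw [h1 m, Set.indicator_of_mem (by exact hz), h2, Pi.sub_apply, h3]

end UntruncatedCommutator

/-! ### Weighted commutator estimate for real functions. -/

section WeightedCommutator

variable {n : ℕ}

theorem isWeight_of_rpow {w : Rn n → ℝ≥0} {s : ℝ} (hs : 0 < s) (hw : IsWeight fun x => w x ^ s) :
    IsWeight w := by
  refine ⟨?_, ?_⟩
  · have h := hw.1.pow_const (1 / s)
    have e : (fun x => (w x ^ s) ^ (1 / s)) = w := by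
      funext x
      rw [← NNReal.rpow_mul, mul_one_div_cancel hs.ne', NNReal.rpow_one]
    rwa [e] at h
  · filter_upwards [hw.2] with x hx
    rcases eq_or_ne (w x) 0 with h | h
    · simp [h, NNReal.zero_rpow hs.ne'] at hx
    · exact pos_iff_ne_zero.2 h

theorem MemApq.setLIntegral_ball_ne_top {P Q : ℝ} (hP : 1 < P) (hQ : 0 < Q) {u : Rn n → ℝ≥0}
    (hu : MemApq P Q u) (x : Rn n) {r : ℝ} (hr : 0 < r) :
    ∫⁻ y in Metric.ball x r, (u y : ℝ≥0∞) ^ Q ≠ ∞ := by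
  obtain ⟨⟨hum, -⟩, C, hC⟩ := hu
  have hθ : 0 < P / (P - 1) := div_pos (by linarith) (by linarith)
  have hB0 : volume (Metric.ball x r) ≠ 0 := (Metric.measure_ball_pos _ _ hr).ne'
  have hB : volume (Metric.ball x r) ≠ ∞ := measure_ball_lt_top.ne
  have hS : ∫⁻ y in Metric.ball x r, (u y : ℝ≥0∞) ^ (-(P / (P - 1))) ≠ 0 := by
    refine ((setLIntegral_pos_iff (hum.coe_nnreal_ennreal.pow_const _)).2 ?_).ne'
    rw [Set.inter_eq_right.2 fun z _ => ?_]
    · exact hB0.bot_lt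
    · simp [hθ.not_gt]
  intro htop
  have h := hC x r hr
  rw [setLAverage_eq, setLAverage_eq, htop, ENNReal.top_div_of_ne_top hB,
    ENNReal.top_rpow_of_pos (by positivity), ENNReal.top_mul] at h
  · exact ENNReal.coe_ne_top (top_le_iff.1 h)
  · simpa [hS, hB] using fun _ => div_nonneg (sub_nonneg.2 hP.le) (by linarith)

/-- Bounded functions of compact support belong to the weighted Lebesgue spaces of the
Muckenhoupt–Wheeden classes. -/
theorem MemLinftyC.mem_weightedLp {p q s : ℝ} (hs : 0 < s) (hsp : s < p) (hpq : p ≤ q)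
    {w : Rn n → ℝ≥0} (hw : MemApq (p / s) (q / s) fun x => w x ^ s) {f : L0 n}
    (hf : MemLinftyC f) : f ∈ WeightedLp p (fun x => w x ^ p) := by
  have hp : 0 < p := hs.trans hsp
  have hq : 0 < q := hp.trans_le hpq
  have hwt : IsWeight w := isWeight_of_rpow hs hw.1
  rw [mem_weightedLp_iff hwt hp, Lp.mem_Lp_iff_memLp]
  obtain ⟨hf1, K, hK, hfK⟩ := hf
  obtain ⟨R, hR⟩ := hK.isBounded.subset_ball_lt 0 0
  set B := Metric.ball (0 : Rn n) R
  have hwm : Measurable fun x => ((w x : ℝ) : ℂ) :=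
    Complex.measurable_ofReal.comp (measurable_coe_nnreal_real.comp hwt.1)
  have hwq : MemLp (fun x => ((w x : ℝ) : ℂ)) (ENNReal.ofReal q) (volume.restrict B) := by
    refine ⟨hwm.aestronglyMeasurable, ?_⟩
    rw [eLpNorm_lt_top_iff_lintegral_rpow_enorm_lt_top (by simpa using hq) ENNReal.ofReal_ne_top,
      ENNReal.toReal_ofReal hq.le]
    have h := hw.setLIntegral_ball_ne_top ((one_lt_div hs).2 hsp) (div_pos hq hs) 0 hR.1
    refine lt_of_le_of_lt (le_of_eq (lintegral_congr fun x => ?_)) h.lt_top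
    rw [ENNReal.coe_rpow_of_nonneg _ hs.le, ← ENNReal.rpow_mul, mul_div_cancel₀ _ hs.ne']
    congr 1
    simp [← ofReal_norm]
  have : IsFiniteMeasure (volume.restrict B) := ⟨by simp [B, measure_ball_lt_top]⟩
  -- The class gives local integrability of `w ^ q`; since `p ≤ q`, this passes to `w ^ p` on a
  -- ball.
  have hwp := hwq.mono_exponent (ENNReal.ofReal_le_ofReal hpq)
  have hprod : MemLp (fun x => ((w x : ℝ) : ℂ) * f x) (ENNReal.ofReal p) (volume.restrict B) :=
    (hf1.restrict B).mul hwp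
  rw [← memLp_indicator_iff_restrict measurableSet_ball] at hprod
  refine hprod.ae_eq ?_
  filter_upwards [coeFn_weightL0_mul hwt f, hfK] with x h1 h2
  rw [h1]
  by_cases hx : x ∈ B
  · rw [Set.indicator_of_mem hx]
  · rw [Set.indicator_of_notMem hx, h2 fun h => hx (hR.2 h), mul_zero]

theorem IsWeight.mul_exp {w : Rn n → ℝ≥0} (hw : IsWeight w) {r : Rn n → ℝ} (hr : Measurable r)
    (σ : ℝ) : IsWeight fun x => w x * (Real.exp (σ * r x)).toNNReal := by
  refine ⟨by have := hw.1; fun_prop, ?_⟩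
  filter_upwards [hw.2] with x hx
  exact mul_pos hx (by simpa using Real.exp_pos _)

theorem coeFn_weightL0_mul_exp {w : Rn n → ℝ≥0} (hw : IsWeight w) {r : Rn n → ℝ}
    (hr : Measurable r) (σ : ℝ) (f : L0 n) : (weightL0 (hw.mul_exp hr σ) * f : L0 n) =ᵐ[volume]
      fun x => (w x : ℂ) * (Real.exp (σ * r x) : ℂ) * f x := by
  filter_upwards [coeFn_weightL0_mul (hw.mul_exp hr σ) f] with x hx
  rw [hx]
  simp [Real.coe_toNNReal _ (Real.exp_pos _).le]

theorem weightL0_mul_exp {w : Rn n → ℝ≥0} (hw : IsWeight w) {r : Rn n → ℝ} (hr : Measurable r)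
    (σ : ℝ) (f : L0 n) :
    weightL0 (hw.mul_exp hr σ) * f = expL0 hr σ * (weightL0 hw * f) := by
  refine AEEqFun.ext ?_
  filter_upwards [coeFn_weightL0_mul_exp hw hr σ f, coeFn_expL0_mul hr σ (weightL0 hw * f),
    coeFn_weightL0_mul hw f] with x h1 h2 h3
  rw [h1, h2, h3]
  ring

/-- This dominates `|r| * w` by the two admissible weights `w * exp (± ε r)`, which gives
integrability of `r * f` for `f` in `L^∞_c`. -/
theorem abs_le_exp_add_exp {ε : ℝ} (hε : 0 < ε) (t : ℝ) :
    |t| ≤ (Real.exp (ε * t) + Real.exp (-ε * t)) / ε := by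
  rw [le_div_iff₀ hε]
  have h1 := Real.add_one_le_exp (ε * t)
  have h2 := Real.add_one_le_exp (-ε * t)
  have h3 := Real.exp_pos (ε * t)
  have h4 := Real.exp_pos (-ε * t)
  rcases abs_cases t with ⟨h, _⟩ | ⟨h, _⟩ <;> rw [h] <;> nlinarith

/-- The commutator with a real function, small exponentials of which preserve the class of
weights. -/
theorem exists_weightedNorm_commutator_le {p q s : ℝ} (hs : 1 < s) (hsp : s < p) (hpq : p ≤ q)
    (T : L0 n →ₗ.[ℂ] L0 n) (hdom : ∀ f : L0 n, MemLinftyC f → f ∈ T.domain)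
    (hT : ∀ w : Rn n → ℝ≥0, MemApq (p / s) (q / s) (fun x => w x ^ s) →
      ∃ C : ℝ≥0, ∀ f : T.domain, (f : L0 n) ∈ WeightedLp p (fun x => w x ^ p) →
        weightedNorm q (fun x => w x ^ q) (T f) ≤
          C * weightedNorm p (fun x => w x ^ p) (f : L0 n))
    {w : Rn n → ℝ≥0} (hw : MemApq (p / s) (q / s) (fun x => w x ^ s))
    [Fact (1 ≤ ENNReal.ofReal p)] [Fact (1 ≤ ENNReal.ofReal q)] (hwt : IsWeight w)
    {S : WeightedLp p (fun x => w x ^ p) →ₗ[ℂ] WeightedLp q (fun x => w x ^ q)}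
    (hS : IsBoundedExtension T S)
    {τ : Lp ℂ (ENNReal.ofReal p) (volume : Measure (Rn n)) →L[ℂ]
        Lp ℂ (ENNReal.ofReal q) (volume : Measure (Rn n))}
    (hτ : ∀ (f : WeightedLp p (fun x => w x ^ p))
          (g : Lp ℂ (ENNReal.ofReal p) (volume : Measure (Rn n))),
          (g : L0 n) = weightL0 hwt * (f : L0 n) → (τ g : L0 n) = weightL0 hwt * (S f : L0 n))
    {r : Rn n → ℝ} (hr : Measurable r) {ε₀ : ℝ} (hε₀ : 0 < ε₀)
    (hexp : ∀ ε : ℝ, |ε| ≤ ε₀ → MemApq (p / s) (q / s)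
      (fun x => w x ^ s * (Real.exp (ε * r x)).toNNReal)) :
    (∀ f : L0 n, MemLinftyC f → realL0 hr * f ∈ WeightedLp p (fun x => w x ^ p)) ∧
    ∃ K : ℝ≥0, ∀ (f : L0 n) (hf : f ∈ WeightedLp p (fun x => w x ^ p))
      (hrf : realL0 hr * f ∈ WeightedLp p (fun x => w x ^ p)),
      weightedNorm q (fun x => w x ^ q)
        (realL0 hr * (S ⟨f, hf⟩ : L0 n) - (S ⟨realL0 hr * f, hrf⟩ : L0 n)) ≤
        K * weightedNorm p (fun x => w x ^ p) f := by
  have hs0 : 0 < s := by linarith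
  have hp : 0 < p := by linarith
  have hq : 0 < q := by linarith
  -- The class concerns `w ^ s`, so an exponent `σ` on `w` becomes `σ * s` there.
  set ε := ε₀ / s with hεd
  have hε : 0 < ε := by positivity
  have hclass : ∀ σ : ℝ, |σ| = ε → MemApq (p / s) (q / s)
      (fun x => (w x * (Real.exp (σ * r x)).toNNReal) ^ s) := by
    intro σ hσ
    have h := hexp (σ * s) (by rw [abs_mul, hσ, abs_of_pos hs0, hεd, div_mul_cancel₀ _ hs0.ne'])
    convert h using 2 with x
    rw [NNReal.mul_rpow]
    congr 1
    rw [← NNReal.coe_inj, NNReal.coe_rpow, Real.coe_toNNReal _ (Real.exp_pos _).le,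
      Real.coe_toNNReal _ (Real.exp_pos _).le, ← Real.exp_mul]
    congr 1; ring
  have hε1 : |ε| = ε := abs_of_pos hε
  have hε2 : |-ε| = ε := by rw [abs_neg, hε1]
  refine ⟨fun f hf => ?_, ?_⟩
  · have h1 := hf.mem_weightedLp hs0 hsp hpq (hclass ε hε1)
    have h2 := hf.mem_weightedLp hs0 hsp hpq (hclass (-ε) hε2)
    rw [mem_weightedLp_iff (hwt.mul_exp hr _) hp, Lp.mem_Lp_iff_memLp] at h1 h2
    rw [mem_weightedLp_iff hwt hp, Lp.mem_Lp_iff_memLp]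
    refine ((h1.norm.add h2.norm).const_mul ε⁻¹).mono (AEEqFun.aestronglyMeasurable _) ?_
    filter_upwards [coeFn_weightL0_mul_exp hwt hr ε f, coeFn_weightL0_mul_exp hwt hr (-ε) f,
      coeFn_weightL0_mul hwt (realL0 hr * f), coeFn_realL0_mul hr f] with x h1 h2 h3 h4
    rw [h3, h4]
    simp only [Pi.add_apply, h1, h2, norm_mul, Complex.norm_real, Real.norm_eq_abs, Real.abs_exp,
      NNReal.abs_eq]
    rw [abs_of_pos (inv_pos.2 hε), abs_of_nonneg (a := _ + _) (by positivity)]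
    have := abs_le_exp_add_exp hε (r x)
    calc _ ≤ (w x : ℝ) * ((Real.exp (ε * r x) + Real.exp (-ε * r x)) / ε * ‖f x‖) := by gcongr
      _ = _ := by field_simp
  · obtain ⟨C₁, hC₁⟩ := hT _ (hclass ε hε1)
    obtain ⟨C₂, hC₂⟩ := hT _ (hclass (-ε) hε2)
    -- On the image of `L^∞_c` the operator `τ` is given by `T` itself, so the bounds of `T` for the
    -- weights `w * exp (± ε r)` apply to `τ`; no comparison of the extensions for different weights
    -- is needed.
    let 𝒟 : Set (Lp ℂ (ENNReal.ofReal p) (volume : Measure (Rn n))) :=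
      {x | ∃ g : L0 n, MemLinftyC g ∧ (x : L0 n) = weightL0 hwt * g}
    have h𝒟 : ∀ φ, ∀ x ∈ 𝒟, mulL (ENNReal.ofReal p) φ x ∈ 𝒟 := by
      rintro φ x ⟨g, hg, hx⟩
      refine ⟨φ * g, hg.mul (Lp.memLp φ), (coe_mulL _ _).trans ?_⟩
      rw [hx]
      exact mul_left_comm _ _ _
    have hC : ∀ σ : ℝ, |σ| = ε → ∀ x ∈ 𝒟,
        eLpNorm (expL0 hr σ * (τ x : L0 n) : L0 n) (ENNReal.ofReal q) volume ≤
          (max C₁ C₂ : ℝ≥0) *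
            eLpNorm (expL0 hr σ * (x : L0 n) : L0 n) (ENNReal.ofReal p) volume := by
      rintro σ hσ x ⟨g, hg, hx⟩
      have hgw := hg.mem_weightedLp hs0 hsp hpq hw
      have e1 : (τ x : L0 n) = weightL0 hwt * (T ⟨g, hdom g hg⟩) := by
        rw [hτ ⟨g, hgw⟩ x hx, hS.2 ⟨g, hdom g hg⟩ hgw]
      rw [e1, hx, ← weightL0_mul_exp, ← weightL0_mul_exp, ← weightedNorm_eq _ hp,
        ← weightedNorm_eq _ hq]
      have hgσ := hg.mem_weightedLp hs0 hsp hpq (hclass σ hσ)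
      rcases (abs_eq hε.le).1 hσ with rfl | rfl
      · exact (hC₁ ⟨g, hdom g hg⟩ hgσ).trans (by gcongr; exact le_max_left _ _)
      · exact (hC₂ ⟨g, hdom g hg⟩ hgσ).trans (by gcongr; exact le_max_right _ _)
    refine ⟨max C₁ C₂ / ε.toNNReal, fun f hf hrf => ?_⟩
    obtain ⟨B, hBm, hBb, hBe, hBf⟩ := exists_memLinftyC_tendsto f
    have h := eLpNorm_commutator_le ENNReal.ofReal_ne_top τ h𝒟 hr hε hC
      (x := ⟨_, (mem_weightedLp_iff hwt hp).1 hf⟩) (y := ⟨_, (mem_weightedLp_iff hwt hp).1 hrf⟩)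
      (mul_left_comm _ _ _) hBm hBe fun k => ⟨(indicatorL _ (hBm k) : L0 n) * f,
        memLinftyC_indicatorL_mul (hBm k) (hBb k) (hBf k),
        (coe_mulL _ _).trans (mul_left_comm _ _ _)⟩
    rw [hτ ⟨f, hf⟩ _ rfl, hτ ⟨_, hrf⟩ _ rfl, mul_left_comm, ← L0.mul_sub,
      ← weightedNorm_eq hwt hq] at h
    refine h.trans ?_
    rw [weightedNorm_eq hwt hp, mul_div_right_comm, ENNReal.ofReal_mul (by positivity),
      ofReal_norm, Lp.enorm_def]
    gcongr
    rw [← ENNReal.ofReal_coe_nnreal]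
    refine ENNReal.ofReal_le_ofReal (le_of_eq ?_)
    rw [NNReal.coe_div, Real.coe_toNNReal _ hε.le]

end WeightedCommutator

/-! ### Complex `BMO` functions and the final extension. -/

section BMOCommutator

variable {n : ℕ} {p q : ℝ} {w : Rn n → ℝ≥0}

/-- Multiplication by `b` as a linear map. -/
noncomputable def mulLinear (b : L0 n) : L0 n →ₗ[ℂ] L0 n where
  toFun f := b * f
  map_add' f g := L0.mul_add b f g
  map_smul' c f := L0.mul_smul c b f

theorem weightedNorm_add_smul_le (hw : IsWeight w) (hq : 1 ≤ q) (c : ℂ) (f g : L0 n) :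
    weightedNorm q (fun x => w x ^ q) (f + c • g) ≤
      weightedNorm q (fun x => w x ^ q) f + ‖c‖ₑ * weightedNorm q (fun x => w x ^ q) g := by
  have hq0 : 0 < q := by linarith
  rw [weightedNorm_eq hw hq0, weightedNorm_eq hw hq0, weightedNorm_eq hw hq0, L0.mul_add,
    L0.mul_smul, eLpNorm_congr_ae (AEEqFun.coeFn_add _ _)]
  refine (eLpNorm_add_le (AEEqFun.aestronglyMeasurable _) (AEEqFun.aestronglyMeasurable _)
    (by simpa using hq)).trans ?_
  rw [eLpNorm_congr_ae (AEEqFun.coeFn_smul c _), eLpNorm_const_smul]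

/-- The commutator `[b, S]` on the space of functions `f` with `f` and `b * f` in `L^p_{w^p}`. -/
noncomputable def weightedCommutator (b : L0 n)
    (S : WeightedLp p (fun x => w x ^ p) →ₗ[ℂ] WeightedLp q (fun x => w x ^ q)) :
    L0 n →ₗ.[ℂ] L0 n where
  domain := WeightedLp p (fun x => w x ^ p) ⊓
    (WeightedLp p (fun x => w x ^ p)).comap (mulLinear b)
  toFun := mulLinear b ∘ₗ Submodule.subtype _ ∘ₗ S ∘ₗ Submodule.inclusion inf_le_left -
    Submodule.subtype _ ∘ₗ S ∘ₗ
      (mulLinear b ∘ₗ Submodule.subtype (WeightedLp p (fun x => w x ^ p) ⊓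
        (WeightedLp p (fun x => w x ^ p)).comap (mulLinear b))).codRestrict _ fun f => f.2.2

theorem weightedCommutator_apply (b : L0 n)
    (S : WeightedLp p (fun x => w x ^ p) →ₗ[ℂ] WeightedLp q (fun x => w x ^ q))
    (f : (weightedCommutator b S).domain) :
    weightedCommutator b S f = b * (S ⟨f, f.2.1⟩ : L0 n) - (S ⟨b * f, f.2.2⟩ : L0 n) := rfl

/-- Used for the real and imaginary parts of `b`, so that the real commutator estimates apply on the
whole natural domain of the complex commutator. -/
theorem mul_mem_weightedLp_of_norm_le (hw : IsWeight w) (hp : 0 < p) {b f : L0 n} {r : Rn n → ℝ}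
    (hr : Measurable r) (hrb : ∀ x, |r x| ≤ ‖b x‖)
    (hbf : b * f ∈ WeightedLp p (fun x => w x ^ p)) :
    realL0 hr * f ∈ WeightedLp p (fun x => w x ^ p) := by
  rw [mem_weightedLp_iff hw hp, Lp.mem_Lp_iff_memLp] at hbf ⊢
  refine hbf.mono (AEEqFun.aestronglyMeasurable _) ?_
  filter_upwards [coeFn_weightL0_mul hw (realL0 hr * f), coeFn_realL0_mul hr f,
    coeFn_weightL0_mul hw (b * f), AEEqFun.coeFn_mul b f] with x h1 h2 h3 h4
  rw [h1, h2, h3, h4]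
  simp only [Pi.mul_apply, norm_mul, Complex.norm_real, Real.norm_eq_abs]
  gcongr
  exact hrb x

theorem eq_realL0_add_I_smul (b : L0 n) (h1 : Measurable fun x => (b x).re)
    (h2 : Measurable fun x => (b x).im) (f : L0 n) :
    b * f = realL0 h1 * f + Complex.I • (realL0 h2 * f) := by
  refine AEEqFun.ext ?_
  filter_upwards [AEEqFun.coeFn_mul b f, AEEqFun.coeFn_add (realL0 h1 * f)
    (Complex.I • (realL0 h2 * f)), AEEqFun.coeFn_smul Complex.I (realL0 h2 * f),
    coeFn_realL0_mul h1 f, coeFn_realL0_mul h2 f] with x e1 e2 e3 e4 e5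
  rw [e1, e2, Pi.add_apply, e3, Pi.smul_apply, e4, e5, Pi.mul_apply]
  nth_rw 1 [← Complex.re_add_im (b x)]
  simp only [smul_eq_mul]
  ring

theorem MemBMO.exists_memApq_mul_exp {P Q : ℝ} (hP : 1 < P) (hQ : 0 < Q) {u : Rn n → ℝ≥0}
    (hu : MemApq P Q u) {b : L0 n} (hb : MemBMO b) {φ : ℂ → ℝ} (hφ0 : Measurable φ)
    (hφ : ∀ z w, |φ z - φ w| ≤ ‖z - w‖) (hφ1 : ∀ z, |φ z| ≤ ‖z‖) :
    ∃ ε₀ > 0, ∀ ε : ℝ, |ε| ≤ ε₀ →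
      MemApq P Q (fun x => u x * (Real.exp (ε * φ (b x))).toNNReal) := by
  obtain ⟨K, hK, c, hc⟩ := hb.exists_cube_oscillation_le hφ
  refine hu.exists_mul_exp hP hQ (hφ0.comp b.measurable) ?_ hK hc
  refine hb.1.mono (hφ0.comp b.measurable).aestronglyMeasurable ?_
  exact Filter.Eventually.of_forall fun x => hφ1 _

end BMOCommutator

theorem mainTheorem2 (n : ℕ) (α p q s : ℝ) (hα : 0 ≤ α) (hαn : α < n)
    (hs : 1 < s) (hsp : s < p) (hpα : p * α < n) (hq : 1 / q = 1 / p - α / n)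
    (T : L0 n →ₗ.[ℂ] L0 n) (hdom : ∀ f : L0 n, MemLinftyC f → f ∈ T.domain)
    (hT : ∀ w : Rn n → ℝ≥0, MemApq (p / s) (q / s) (fun x => w x ^ s) →
      ∃ C : ℝ≥0, ∀ f : T.domain, (f : L0 n) ∈ WeightedLp p (fun x => w x ^ p) →
        weightedNorm q (fun x => w x ^ q) (T f) ≤
          C * weightedNorm p (fun x => w x ^ p) (f : L0 n)) :
    ∀ w : Rn n → ℝ≥0, MemApq (p / s) (q / s) (fun x => w x ^ s) →
      ∃ Tw : WeightedLp p (fun x => w x ^ p) →ₗ[ℂ] WeightedLp q (fun x => w x ^ q),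
        IsBoundedExtension T Tw ∧ (∀ T', IsBoundedExtension T T' → T' = Tw) ∧
        ∀ b : L0 n, MemBMO b →
          (∀ f : L0 n, MemLinftyC f →
            f ∈ WeightedLp p (fun x => w x ^ p) ∧ b * f ∈ WeightedLp p (fun x => w x ^ p)) ∧
          ∃ S : WeightedLp p (fun x => w x ^ p) →ₗ[ℂ] WeightedLp q (fun x => w x ^ q),
            IsBoundedOp S ∧
            ∀ (f : L0 n) (hf : f ∈ WeightedLp p (fun x => w x ^ p))
              (hbf : b * f ∈ WeightedLp p (fun x => w x ^ p)),
              (S ⟨f, hf⟩ : L0 n) = b * (Tw ⟨f, hf⟩ : L0 n) - (Tw ⟨b * f, hbf⟩ : L0 n) := by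
  intro w hw
  have hs0 : 0 < s := by linarith
  have hp1 : 1 ≤ p := by linarith
  have hp : 0 < p := by linarith
  have hn : (0 : ℝ) < n := by linarith
  have hq1 : 0 < 1 / q := by
    rw [hq, sub_pos, div_lt_div_iff₀ hn hp]
    linarith
  have hq0 : 0 < q := by simpa using hq1
  have hpq : p ≤ q := by
    have h : 1 / q ≤ 1 / p := by rw [hq]; linarith [div_nonneg hα hn.le]
    exact (one_div_le_one_div hq0 hp).1 h
  have hq1 : 1 ≤ q := hp1.trans hpq
  have : Fact (1 ≤ ENNReal.ofReal p) := ⟨by simpa using hp1⟩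
  have : Fact (1 ≤ ENNReal.ofReal q) := ⟨by simpa using hq1⟩
  have hwt : IsWeight w := isWeight_of_rpow hs0 hw.1
  have hlin : ∀ f : L0 n, MemLinftyC f → f ∈ WeightedLp p (fun x => w x ^ p) :=
    fun f hf => hf.mem_weightedLp hs0 hsp hpq hw
  obtain ⟨C, hC⟩ := hT w hw
  obtain ⟨Tw, hTw, huniq, τ, hτ⟩ := existsUnique_boundedExtension hp1 hq1 hwt hlin T hdom hC
  refine ⟨Tw, hTw, huniq, fun b hb => ?_⟩
  have hP : 1 < p / s := (one_lt_div hs0).2 hsp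
  have hQ : 0 < q / s := by positivity
  have hre : Measurable fun x => (b x).re := Complex.measurable_re.comp b.measurable
  have him : Measurable fun x => (b x).im := Complex.measurable_im.comp b.measurable
  obtain ⟨ε₁, hε₁, hexp₁⟩ := hb.exists_memApq_mul_exp hP hQ hw Complex.measurable_re
    (fun z w => by rw [← Complex.sub_re]; exact Complex.abs_re_le_norm _) Complex.abs_re_le_norm
  obtain ⟨ε₂, hε₂, hexp₂⟩ := hb.exists_memApq_mul_exp hP hQ hw Complex.measurable_im
    (fun z w => by rw [← Complex.sub_im]; exact Complex.abs_im_le_norm _) Complex.abs_im_le_norm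
  obtain ⟨hre_mem, K₁, hK₁⟩ := exists_weightedNorm_commutator_le hs hsp hpq T hdom hT hw hwt hTw hτ
    hre hε₁ hexp₁
  obtain ⟨him_mem, K₂, hK₂⟩ := exists_weightedNorm_commutator_le hs hsp hpq T hdom hT hw hwt hTw hτ
    him hε₂ hexp₂
  have hb_mem : ∀ f : L0 n, MemLinftyC f → b * f ∈ WeightedLp p (fun x => w x ^ p) := by
    intro f hf
    rw [eq_realL0_add_I_smul b hre him]
    exact Submodule.add_mem _ (hre_mem f hf) (Submodule.smul_mem _ _ (him_mem f hf))
  refine ⟨fun f hf => ⟨hlin f hf, hb_mem f hf⟩, ?_⟩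
  -- The operator extended is the commutator on its full natural domain, which contains `L^∞_c`;
  -- hence the formula for `S` holds whenever `f` and `b * f` lie in the weighted space.
  obtain ⟨S, hS, -⟩ := existsUnique_boundedExtension hp1 hq1 hwt hlin (weightedCommutator b Tw)
    (fun f hf => ⟨hlin f hf, hb_mem f hf⟩) (C := K₁ + K₂) (by
      rintro ⟨f, hf, hbf⟩ -
      have h1 := mul_mem_weightedLp_of_norm_le hwt hp hre (fun x => Complex.abs_re_le_norm _) hbf
      have h2 := mul_mem_weightedLp_of_norm_le hwt hp him (fun x => Complex.abs_im_le_norm _) hbf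
      have key : (weightedCommutator b Tw ⟨f, hf, hbf⟩ : L0 n) =
          (realL0 hre * (Tw ⟨f, hf⟩ : L0 n) - (Tw ⟨realL0 hre * f, h1⟩ : L0 n)) +
          Complex.I •
            (realL0 him * (Tw ⟨f, hf⟩ : L0 n) - (Tw ⟨realL0 him * f, h2⟩ : L0 n)) := by
        have e : (⟨b * f, hbf⟩ : WeightedLp p (fun x => w x ^ p)) =
            ⟨realL0 hre * f, h1⟩ + Complex.I • ⟨realL0 him * f, h2⟩ :=
          Subtype.ext (eq_realL0_add_I_smul b hre him f)
        rw [weightedCommutator_apply, eq_realL0_add_I_smul b hre him, e, map_add, map_smul,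
          Submodule.coe_add, Submodule.coe_smul, smul_sub]
        abel
      rw [key]
      refine (weightedNorm_add_smul_le hwt hq1 _ _ _).trans ?_
      rw [ENNReal.coe_add, add_mul]
      refine add_le_add (hK₁ f hf h1) ?_
      simpa [← ofReal_norm] using hK₂ f hf h2)
  exact ⟨S, hS.1, fun f hf hbf => (hS.2 ⟨f, hf, hbf⟩ hf).trans (weightedCommutator_apply b Tw _)⟩
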